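/- Let $m\ge 2$, let $\mathbb{B}\subset\mathbb{R}^{2m}$ be the open unit ball with coordinates $(x_1,y_1,\dots,x_m,y_m)$, and let $\lambda=\frac12\sum_{i=1}^m (x_i\,dy_i-y_i\,dx_i)$. A contact form on $\mathbb{R}/L\mathbb{Z}\times\mathbb{B}$ is a smooth $1$-form $\beta$ such that $\beta\wedge(d\beta)^m$ vanishes nowhere; its Reeb vector field $R_\beta$ is defined by $\beta(R_\beta)=1$ and $\iota_{R_\beta}d\beta=0$, and its contact volume is $\mathrm{vol}(\mathbb{R}/L\mathbb{Z}\times\mathbb{B},\beta)=\int_{\mathbb{R}/L\mathbb{Z}\times\mathbb{B}}\beta\wedge(d\beta)^m$, where $\mathbb{R}/L\mathbb{Z}\times\mathbb{B}$ is oriented by $ds\wedge dx_1\wedge dy_1\wedge\dots\wedge dx_m\wedge dy_m$ and $s$ is the coordinate on $\mathbb{R}/L\mathbb{Z}$. For every $\varepsilon>0$ and $L>0$ there is a smooth contact form $\beta$ on $\mathbb{R}/L\mathbb{Z}\times\mathbb{B}$ such that: 1. the integral defining the contact volume converges and $\mathrm{vol}(\mathbb{R}/L\mathbb{Z}\times\mathbb{B},\beta)\le\varepsilon$;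 2. $\beta=ds+\lambda$ on a neighbourhood of the boundary $\mathbb{R}/L\mathbb{Z}\times\partial\mathbb{B}$; in particular $R_\beta=\partial_s$ there, and the flow of $R_\beta$ is defined for all times on $\mathbb{R}/L\mathbb{Z}\times\mathbb{B}$; 3. every closed orbit of $R_\beta$ has period at least $L$; 4. $\beta$ is smoothly isotopic to $ds+\lambda$ through contact forms rel boundary: there is a path $(\beta_t)_{t\in[0,1]}$ of contact forms on $\mathbb{R}/L\mathbb{Z}\times\mathbb{B}$, smooth jointly in $t$ and the point, with $\beta_0=\beta$, $\beta_1=ds+\lambda$, and such that all $\beta_t$ coincide with $ds+\lambda$ on one fixed neighbourhood of $\mathbb{R}/L\mathbb{Z}\times\partial\mathbb{B}$. -/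

import Mathlib

open Set Filter Topology MeasureTheory
open scoped ContDiff

noncomputable section

namespace ContactPlug

/-- `ℝ^{2m}` with its Euclidean norm. The coordinate `(i, 0)` is `x_i` and the coordinate
`(i, 1)` is `y_i`. -/
abbrev Plane (m : ℕ) : Type := EuclideanSpace ℝ (Fin m × Fin 2)

/-- The manifold `ℝ/Lℤ × ℝ^{2m}`. -/
abbrev Tube (L : ℝ) (m : ℕ) : Type := AddCircle L × Plane m

/-- The model vector space `ℝ × ℝ^{2m}`. Through the coordinate vector fields
`∂_s, ∂_{x_i}, ∂_{y_i}` it is the tangent space of `ℝ/Lℤ × ℝ^{2m}` at every point. -/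
abbrev TubeVec (m : ℕ) : Type := ℝ × Plane m

/-- The open submanifold `ℝ/Lℤ × 𝔹`, where `𝔹` is the open unit ball. -/
def plug (L : ℝ) (m : ℕ) : Set (Tube L m) := univ ×ˢ Metric.ball (0 : Plane m) 1

/-- The universal covering `(s, z) ↦ (s mod L, z)`; it is a local diffeomorphism. -/
def cover (L : ℝ) (m : ℕ) (p : TubeVec m) : Tube L m := ((p.1 : AddCircle L), p.2)

/-- A 1-form: a linear functional on the tangent space at each point. -/
abbrev OneForm (L : ℝ) (m : ℕ) : Type := Tube L m → (TubeVec m →L[ℝ] ℝ)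

/-- The 1-form `λ = ½ ∑ (x_i dy_i - y_i dx_i)` on `ℝ^{2m}`. -/
def liouville (m : ℕ) (z : Plane m) : Plane m →L[ℝ] ℝ :=
  (1 / 2 : ℝ) • ∑ i : Fin m,
    (z (i, 0) • (EuclideanSpace.proj (i, 1) : Plane m →L[ℝ] ℝ)
      - z (i, 1) • (EuclideanSpace.proj (i, 0) : Plane m →L[ℝ] ℝ))

/-- The 1-form `ds + λ`. -/
def stdForm (L : ℝ) (m : ℕ) : OneForm L m := fun x =>
  ContinuousLinearMap.fst ℝ ℝ (Plane m)
    + (liouville m x.2).comp (ContinuousLinearMap.snd ℝ ℝ (Plane m))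

/-- The exterior derivative `dβ` at the point `x`: Mathlib's exterior derivative of `β` read in
the chart `p ↦ x + p mod L` centred at `x`, whose coordinate frame is the one used for all
tangent spaces. -/
def dForm {L : ℝ} {m : ℕ} (β : OneForm L m) (x : Tube L m) : TubeVec m [⋀^Fin 2]→L[ℝ] ℝ :=
  extDeriv (fun p : TubeVec m =>
    ContinuousAlternatingMap.ofSubsingleton ℝ (TubeVec m) ℝ (0 : Fin 1) (β (x + cover L m p))) 0

/-- The usual formula `dβ(u, v) = D_u (β(v)) - D_v (β(u))` for constant `u`, `v`. -/
theorem dForm_apply {L : ℝ} {m : ℕ} (β : OneForm L m) (x : Tube L m) (u v : TubeVec m) :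
    dForm β x ![u, v] = fderiv ℝ (fun p : TubeVec m => β (x + cover L m p)) 0 u v
      - fderiv ℝ (fun p : TubeVec m => β (x + cover L m p)) 0 v u := by
  let e : (TubeVec m →L[ℝ] ℝ) ≃ₗᵢ[ℝ] (TubeVec m [⋀^Fin 1]→L[ℝ] ℝ) :=
    ContinuousAlternatingMap.ofSubsingletonLIE (0 : Fin 1)
  have h : fderiv ℝ (fun p : TubeVec m => ContinuousAlternatingMap.ofSubsingleton ℝ (TubeVec m) ℝ
        (0 : Fin 1) (β (x + cover L m p))) 0
      = (e.toContinuousLinearEquiv : _ →L[ℝ] _).comp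
          (fderiv ℝ (fun p : TubeVec m => β (x + cover L m p)) 0) :=
    e.toContinuousLinearEquiv.comp_fderiv
  rw [dForm, extDeriv, h]
  simp [ContinuousAlternatingMap.alternatizeUncurryFin_apply, Fin.sum_univ_two, e, sub_eq_add_neg]
  rfl

/-- The `(2m+1)`-form `β ∧ (dβ)^m` at the point `x`. The index `none` marks the first argument
and `(i, 0), (i, 1)` mark the `i`-th pair of the remaining ones. Since the factors have degrees
`1, 2, …, 2`, the wedge product is the signed sum over all permutations of the arguments, divided
by `1! * (2!)^m`; so `dx ∧ dy` takes the value `1` on `(∂_x, ∂_y)`. -/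
def topForm {L : ℝ} {m : ℕ} (β : OneForm L m) (x : Tube L m)
    (v : Option (Fin m × Fin 2) → TubeVec m) : ℝ :=
  (1 / 2 ^ m : ℝ) * ∑ σ : Equiv.Perm (Option (Fin m × Fin 2)),
    ((Equiv.Perm.sign σ : ℤ) : ℝ) *
      (β x (v (σ none)) * ∏ i : Fin m, dForm β x ![v (σ (some (i, 0))), v (σ (some (i, 1)))])

/-- The coordinate frame `∂_s, ∂_{x_1}, ∂_{y_1}, …, ∂_{x_m}, ∂_{y_m}`. -/
def frame (m : ℕ) : Option (Fin m × Fin 2) → TubeVec m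
  | none => (1, 0)
  | some j => (0, EuclideanSpace.single j 1)

/-- `β` is smooth on `ℝ/Lℤ × 𝔹`, i.e. its pull-back to `ℝ × 𝔹` is smooth. -/
def SmoothForm {L : ℝ} {m : ℕ} (β : OneForm L m) : Prop :=
  ContDiffOn ℝ ∞ (fun p : TubeVec m => β (cover L m p)) (cover L m ⁻¹' plug L m)

/-- `β` is a smooth contact form on `ℝ/Lℤ × 𝔹`: `β ∧ (dβ)^m` vanishes nowhere. -/
def IsContactForm {L : ℝ} {m : ℕ} (β : OneForm L m) : Prop :=
  SmoothForm β ∧ ∀ x ∈ plug L m, topForm β x ≠ 0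

/-- `U` is an open neighbourhood of the boundary `ℝ/Lℤ × ∂𝔹`. -/
def IsBoundaryNhd {L : ℝ} {m : ℕ} (U : Set (Tube L m)) : Prop :=
  IsOpen U ∧ frontier (plug L m) ⊆ U

/-- `b` and `β` are joined by a path of smooth contact forms, smooth jointly in the parameter and
the point, all of which agree with `β` on one fixed neighbourhood of the boundary. -/
def ContactIsotopicRelBoundary {L : ℝ} {m : ℕ} (b β : OneForm L m) : Prop :=
  ∃ (B : ℝ → OneForm L m) (U : Set (Tube L m)),
    ContDiffOn ℝ ∞ (fun q : ℝ × TubeVec m => B q.1 (cover L m q.2))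
      (Icc (0 : ℝ) 1 ×ˢ (cover L m ⁻¹' plug L m)) ∧
    (∀ t ∈ Icc (0 : ℝ) 1, IsContactForm (B t)) ∧
    (∀ x ∈ plug L m, B 0 x = b x) ∧
    (∀ x ∈ plug L m, B 1 x = β x) ∧
    IsBoundaryNhd U ∧
    ∀ t ∈ Icc (0 : ℝ) 1, ∀ x ∈ U ∩ plug L m, B t x = β x

/-- The density of `β ∧ (dβ)^m` with respect to `ds dx_1 dy_1 … dx_m dy_m`. -/
def volDensity {L : ℝ} {m : ℕ} (β : OneForm L m) (x : Tube L m) : ℝ := topForm β x (frame m)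

/-- The contact volume `∫ β ∧ (dβ)^m` over `ℝ/Lℤ × 𝔹`, oriented by `ds ∧ dx_1 ∧ dy_1 ∧ …`. The
measure on `ℝ/Lℤ` is the Lebesgue measure, of total mass `L`. -/
def contactVolume {L : ℝ} [Fact (0 < L)] {m : ℕ} (β : OneForm L m) : ℝ :=
  ∫ x in plug L m, volDensity β x

/-- `v` is the Reeb vector of `β` at `x`: `β(v) = 1` and `ι_v dβ = 0`. -/
def IsReebVector {L : ℝ} {m : ℕ} (β : OneForm L m) (x : Tube L m) (v : TubeVec m) : Prop :=
  β x v = 1 ∧ ∀ w : TubeVec m, dForm β x ![v, w] = 0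

/-- The curve `γ` in `ℝ/Lℤ × ℝ^{2m}` has velocity `v` at time `t`. -/
def HasVelocityAt {L : ℝ} {m : ℕ} (γ : ℝ → Tube L m) (v : TubeVec m) (t : ℝ) : Prop :=
  ∃ c : ℝ → TubeVec m, (∀ᶠ τ in 𝓝 t, cover L m (c τ) = γ τ) ∧ HasDerivAt c v t

/-- `γ` is an orbit in `ℝ/Lℤ × 𝔹` of the Reeb vector field of `β`, defined for all times. -/
def IsReebOrbit {L : ℝ} {m : ℕ} (β : OneForm L m) (γ : ℝ → Tube L m) : Prop :=
  ∀ t : ℝ, γ t ∈ plug L m ∧ ∃ v : TubeVec m, IsReebVector β (γ t) v ∧ HasVelocityAt γ v t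

end ContactPlug

end

noncomputable section

namespace ContactPlug

/-! Take `β = H ds + λ`. If `X` is the Hamiltonian vector of `H` in the ball directions, then `(1,
X)` spans the kernel of `dβ`. Hence `β ∧ (dβ)^m` is a positive constant times the density `H - ½
dH(0, z)` (`volDensity_hamForm`), and the Reeb field is `(1, X)` divided by that density. Small
volume therefore makes orbits run fast around the circle, and the task is to prevent fast orbits
from closing up after few turns.

Let `ρ = |z|²`, let `ζ` be one complex coordinate and `a = (Im (e^{-2πis/L} ζ^N))²`. The plug is `H
= 1 + π/(NL) cap₁(ρ) - a/(a+κ) cap₂(ρ)`, where `cap_c` smooths `max (1 - c/N - ρ) 0`. Since `A - ρ`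
contributes the constant `A` to the density, for `κ → 0` the density becomes `O(1/N)` at each
interior point with `a ≠ 0`. Dominated convergence, in `κ` for fixed `N` and then in `N`, makes the
volume small (`exists_integral_plugDensity_lt`).

The rotation term turns `z` by the angle `2π/N` per turn of `s`, so it preserves both `a` and `ρ`
wherever `cap₂` lives. The twisting term is thus a first integral (`twistDeriv_hamVector`). On a
closed orbit where it vanishes the density is at least `1`, so one turn takes time at least `L`. On
any other closed orbit `e^{-2πis/L} ζ^N` never becomes real, so its `N`-th root `e^{-2πis/(NL)} ζ`
closes up, and `s` advances by a positive multiple of `NL`. As the density is at least `2/N`, this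
takes time at least `2L` (`le_period_of_reeb`).

The density is affine in `H`, so interpolating linearly from `H` to `1` stays among contact forms.
-/

/-! ### Linear algebra of the standard symplectic form -/

/-- The alternating sum `∑ σ, sign σ ∏ ω (e_{σ (i, 0)}, e_{σ (i, 1)})`, where `ω j k` is the value
of the standard symplectic form on the coordinate vectors `j` and `k`. -/
def symplecticCoeff {m : ℕ} (j k : Fin m × Fin 2) : ℝ :=
  if j.1 = k.1 then (if j.2 = 0 ∧ k.2 = 1 then 1 else if j.2 = 1 ∧ k.2 = 0 then -1 else 0) else 0

/-- A permutation contributes only if it maps coordinate pairs to coordinate pairs. Then it is a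
permutation of the pairs composed with swaps inside them, and both its sign and the product equal
the product of the signs of the swaps. -/
theorem sign_mul_prod_symplecticCoeff_nonneg {m : ℕ} (σ : Equiv.Perm (Fin m × Fin 2)) :
    0 ≤ ((Equiv.Perm.sign σ : ℤ) : ℝ) * ∏ i : Fin m, symplecticCoeff (σ (i, 0)) (σ (i, 1)) := by
  by_cases h : ∀ i, (σ (i, 0)).1 = (σ (i, 1)).1
  swap
  · push Not at h
    obtain ⟨i, hi⟩ := h
    rw [Finset.prod_eq_zero (Finset.mem_univ i) (by simp [symplecticCoeff, hi])]
    simp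
  have hfib : ∀ i k, (σ (i, k)).1 = (σ (i, 0)).1 := by
    intro i k
    fin_cases k
    · rfl
    · exact (h i).symm
  -- Pigeonhole: two pairs sent into the same block would need more than two distinct values in `Fin
  -- 2`.
  have hinj : Function.Injective fun i => (σ (i, 0)).1 := by
    intro i j hij
    by_contra hne
    have h1 : ∀ k l, σ (i, k) ≠ σ (j, l) := fun k l e => hne (congrArg Prod.fst (σ.injective e))
    have h2 : ∀ k l, (σ (i, k)).2 ≠ (σ (j, l)).2 := fun k l e =>
      h1 k l (Prod.ext (by rw [hfib i k, hfib j l]; exact hij) e)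
    have h3 : (σ (i, 0)).2 ≠ (σ (i, 1)).2 := fun e => by
      have := σ.injective (Prod.ext (h i) e)
      simp at this
    have a := h2 0 0
    have b := h2 1 0
    omega
  let π : Equiv.Perm (Fin m) := Equiv.ofBijective _ (Finite.injective_iff_bijective.1 hinj)
  let P : Equiv.Perm (Fin m × Fin 2) := Equiv.prodCongrLeft fun _ => π
  have hf : ∀ i, Function.Injective fun k => (σ (i, k)).2 := by
    intro i k l e
    have := σ.injective (a₁ := (i, k)) (a₂ := (i, l))
      (Prod.ext ((hfib i k).trans (hfib i l).symm) e)
    simpa using this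
  let f : Fin m → Equiv.Perm (Fin 2) := fun i =>
    Equiv.ofBijective _ (Finite.injective_iff_bijective.1 (hf i))
  have hσ : σ = P * Equiv.prodCongrRight f := by
    ext ⟨i, k⟩
    · simp [P, π, f, hfib i k]
    · simp [P, π, f]
  -- `P` applies `π` once for each element of `Fin 2`, so its sign is a square.
  have hsign : Equiv.Perm.sign σ = ∏ i, Equiv.Perm.sign (f i) := by
    rw [hσ, map_mul, Equiv.Perm.sign_prodCongrRight, Equiv.Perm.sign_prodCongrLeft]
    simp
  have hterm : ∀ i, symplecticCoeff (σ (i, 0)) (σ (i, 1))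
      = ((Equiv.Perm.sign (f i) : ℤ) : ℝ) := by
    intro i
    have h0 : (σ (i, 0)).2 = f i 0 := rfl
    have h1 : (σ (i, 1)).2 = f i 1 := rfl
    simp only [symplecticCoeff, h i, if_true, h0, h1]
    generalize f i = g
    revert g
    have key : ∀ g : Equiv.Perm (Fin 2), (g 0 = 0 ∧ g 1 = 1 ∧ Equiv.Perm.sign g = 1) ∨
        (g 0 = 1 ∧ g 1 = 0 ∧ Equiv.Perm.sign g = -1) := by decide
    intro g
    rcases key g with ⟨a, b, c⟩ | ⟨a, b, c⟩ <;> simp [a, b, c]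
  simp only [hterm, hsign]
  rw [Units.coe_prod, Int.cast_prod, ← Finset.prod_mul_distrib]
  exact Finset.prod_nonneg fun i _ => mul_self_nonneg _

/-- The value of `ω ^ m` on the symplectic coordinate frame. -/
def symplecticConst (m : ℕ) : ℝ :=
  (1 / 2 ^ m : ℝ) * ∑ σ : Equiv.Perm (Fin m × Fin 2),
    ((Equiv.Perm.sign σ : ℤ) : ℝ) * ∏ i : Fin m, symplecticCoeff (σ (i, 0)) (σ (i, 1))

theorem symplecticConst_pos (m : ℕ) : 0 < symplecticConst m := by
  refine mul_pos (by positivity) ?_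
  refine Finset.sum_pos' (fun σ _ => sign_mul_prod_symplecticCoeff_nonneg σ)
    ⟨1, Finset.mem_univ _, ?_⟩
  simp [symplecticCoeff]

/-- The symplectic gradient of a linear functional. -/
def sgrad {m : ℕ} (l : Plane m →L[ℝ] ℝ) : Plane m :=
  WithLp.toLp 2 fun j => if j.2 = 0 then l (EuclideanSpace.single (j.1, 1) 1)
    else - l (EuclideanSpace.single (j.1, 0) 1)

theorem liouville_apply {m : ℕ} (z w : Plane m) :
    liouville m z w = (1 / 2 : ℝ) * ∑ i : Fin m, (z (i, 0) * w (i, 1) - z (i, 1) * w (i, 0)) := by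
  simp [liouville]

theorem liouville_swap {m : ℕ} (z w : Plane m) : liouville m z w = - liouville m w z := by
  simp only [liouville_apply]
  rw [← mul_neg, ← Finset.sum_neg_distrib]
  congr 1
  exact Finset.sum_congr rfl fun i _ => by ring

theorem liouville_self {m : ℕ} (z : Plane m) : liouville m z z = 0 := by
  have := liouville_swap z z
  linarith

theorem apply_eq_sum_single {m : ℕ} (l : Plane m →L[ℝ] ℝ) (w : Plane m) :
    l w = ∑ j, w j * l (EuclideanSpace.single j 1) := by
  conv_lhs => rw [← (EuclideanSpace.basisFun (Fin m × Fin 2) ℝ).sum_repr w]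
  simp [map_sum]

theorem two_mul_liouville_sgrad {m : ℕ} (l : Plane m →L[ℝ] ℝ) (w : Plane m) :
    2 * liouville m (sgrad l) w = l w := by
  rw [liouville_apply, apply_eq_sum_single l w, Fintype.sum_prod_type]
  simp only [Fin.sum_univ_two, sgrad]
  rw [← mul_assoc]
  norm_num
  exact Finset.sum_congr rfl fun i _ => by ring

/-- Nondegeneracy of `dλ`, tested on coordinate vectors. -/
theorem eq_of_liouville_eq {m : ℕ} {z w : Plane m} (h : ∀ v, liouville m z v = liouville m w v) :
    z = w := by
  ext ⟨i, k⟩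
  fin_cases k
  · have := h (EuclideanSpace.single (i, 1) 1)
    simp [liouville_apply] at this
    simpa using this
  · have := h (EuclideanSpace.single (i, 0) 1)
    simp [liouville_apply] at this
    simpa using this

theorem two_mul_liouville_single {m : ℕ} (j k : Fin m × Fin 2) :
    2 * liouville m (EuclideanSpace.single j 1) (EuclideanSpace.single k 1)
      = symplecticCoeff j k := by
  obtain ⟨j, a⟩ := j
  obtain ⟨k, b⟩ := k
  rw [liouville_apply, ← mul_assoc]
  norm_num [PiLp.single_apply, symplecticCoeff, Prod.ext_iff]
  fin_cases a <;> fin_cases b <;> simp [Finset.sum_ite_eq, eq_comm]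
  split_ifs <;> simp

/-! ### The top-degree form on the coordinate frame -/

/-- The multilinear map underlying the wedge product of `b` with the `m`-th power of the
antisymmetrization of `c`. -/
def pairingMultilinear {m : ℕ} (b : TubeVec m →L[ℝ] ℝ) (c : TubeVec m →L[ℝ] TubeVec m →L[ℝ] ℝ) :
    MultilinearMap ℝ (fun _ : Option (Fin m × Fin 2) => TubeVec m) ℝ where
  toFun v := b (v none) * ∏ i : Fin m, c (v (some (i, 0))) (v (some (i, 1)))
  map_update_add' := by
    intro _ v k x y
    rcases k with _ | ⟨i, k⟩
    · simp [add_mul]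
    · rw [Fintype.prod_eq_mul_prod_compl i, Fintype.prod_eq_mul_prod_compl i,
        Fintype.prod_eq_mul_prod_compl i]
      have key : ∀ w : TubeVec m,
          ∏ j ∈ {i}ᶜ, c (Function.update v (some (i, k)) w (some (j, 0)))
            (Function.update v (some (i, k)) w (some (j, 1)))
          = ∏ j ∈ {i}ᶜ, c (v (some (j, 0))) (v (some (j, 1))) := fun w =>
        Finset.prod_congr rfl fun j hj => by
          have : j ≠ i := by simpa using hj
          simp [this]
      simp only [key]
      fin_cases k <;> simp <;> ring
  map_update_smul' := by
    intro _ v k r x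
    rcases k with _ | ⟨i, k⟩
    · simp [mul_assoc]
    · rw [Fintype.prod_eq_mul_prod_compl i, Fintype.prod_eq_mul_prod_compl i]
      have key : ∀ w : TubeVec m,
          ∏ j ∈ {i}ᶜ, c (Function.update v (some (i, k)) w (some (j, 0)))
            (Function.update v (some (i, k)) w (some (j, 1)))
          = ∏ j ∈ {i}ᶜ, c (v (some (j, 0))) (v (some (j, 1))) := fun w =>
        Finset.prod_congr rfl fun j hj => by
          have : j ≠ i := by simpa using hj
          simp [this]
      simp only [key]
      fin_cases k <;> simp <;> ring

theorem topForm_eq_alternatization {L : ℝ} {m : ℕ} {β : OneForm L m} {x : Tube L m}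
    {c : TubeVec m →L[ℝ] TubeVec m →L[ℝ] ℝ} (hc : ∀ u v, dForm β x ![u, v] = c u v)
    (v : Option (Fin m × Fin 2) → TubeVec m) :
    topForm β x v = (1 / 2 ^ m : ℝ) * (pairingMultilinear (β x) c).alternatization v := by
  rw [topForm, MultilinearMap.alternatization_apply]
  congr 1
  refine Finset.sum_congr rfl fun σ _ => ?_
  simp [pairingMultilinear, hc, Units.smul_def]

theorem alternatingMap_update_add_sum {ι M : Type*} [DecidableEq ι] [Fintype ι]
    [AddCommGroup M] [Module ℝ M] (f : M [⋀^Option ι]→ₗ[ℝ] ℝ) (v : Option ι → M) (a : ι → ℝ) :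
    f (Function.update v none (v none + ∑ j, a j • v (some j))) = f v := by
  rw [f.map_update_add, Function.update_eq_self, f.map_update_sum]
  simp only [f.map_update_smul]
  rw [Finset.sum_eq_zero, add_zero]
  intro j _
  rw [f.map_update_self v (by simp), smul_zero]

/-- If `ω = dλ` and `R` spans the kernel of `dβ` and projects to `∂_s`, then
`β ∧ (dβ)^m = β(R) ds ∧ ω ^ m`. -/
theorem topForm_frame {L : ℝ} {m : ℕ} {β : OneForm L m} {x : Tube L m}
    {c : TubeVec m →L[ℝ] TubeVec m →L[ℝ] ℝ} (hc : ∀ u v, dForm β x ![u, v] = c u v)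
    (hω : ∀ z w : Plane m, c (0, z) (0, w) = 2 * liouville m z w)
    {X : Plane m} (hX : ∀ w, c (1, X) w = 0) (hX' : ∀ w, c w (1, X) = 0) :
    topForm β x (frame m) = symplecticConst m * β x (1, X) := by
  have hR : (1, X) = frame m none + ∑ j, X j • frame m (some j) := by
    have : ∑ j, X j • frame m (some j) = ((0 : ℝ), X) := by
      ext1
      · simp [frame, Prod.fst_sum]
      · rw [Prod.snd_sum]
        conv_rhs => rw [← (EuclideanSpace.basisFun (Fin m × Fin 2) ℝ).sum_repr X]
        simp [frame]
    rw [this]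
    simp [frame]
  -- An alternating form does not see multiples of the other frame vectors added to `∂_s`, so `∂_s`
  -- may be replaced by the kernel vector `(1, X)`.
  rw [topForm_eq_alternatization hc, ← alternatingMap_update_add_sum _ _ X, ← hR,
    symplecticConst, mul_assoc]
  congr 1
  rw [MultilinearMap.alternatization_apply,
    ← (Equiv.Perm.decomposeOption (α := Fin m × Fin 2)).symm.sum_comp, Fintype.sum_prod_type,
    Finset.sum_mul, Fintype.sum_eq_single none]
  · refine Finset.sum_congr rfl fun σ _ => ?_
    simp [pairingMultilinear, Units.smul_def, frame, hω, two_mul_liouville_single]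
    ring
  -- A permutation moving `none` feeds the kernel vector to a factor `dβ`, so its term vanishes.
  · rintro (_ | ⟨i, k⟩) hne
    · exact absurd rfl hne
    refine Finset.sum_eq_zero fun σ _ => ?_
    have hτ : Equiv.Perm.decomposeOption.symm (some (i, k), σ) none = some (i, k) := by simp
    generalize Equiv.Perm.decomposeOption.symm (some (i, k), σ) = τ at hτ
    obtain ⟨y, hy⟩ := τ.surjective none
    rcases y with _ | ⟨j, l⟩
    · rw [hτ] at hy
      exact absurd hy (by simp)
    have hzero : pairingMultilinear (β x) c
        (fun t => Function.update (frame m) none (1, X) (τ t)) = 0 := by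
      simp only [pairingMultilinear, MultilinearMap.coe_mk]
      refine mul_eq_zero_of_right _ (Finset.prod_eq_zero (Finset.mem_univ j) ?_)
      fin_cases l
      · rw [show τ (some (j, 0)) = none from hy, Function.update_self, hX]
      · rw [show τ (some (j, 1)) = none from hy, Function.update_self, hX']
    simp only [MultilinearMap.domDomCongr_apply]
    rw [hzero, smul_zero]

/-- The bilinear form `(z, w) ↦ λ_z(w)`. -/
def liouvilleBilin (m : ℕ) : Plane m →L[ℝ] Plane m →L[ℝ] ℝ :=
  LinearMap.toContinuousLinearMap
    { toFun := liouville m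
      map_add' := fun z w => by
        ext v
        simp only [liouville_apply, add_apply, PiLp.add_apply, ← mul_add,
          ← Finset.sum_add_distrib]
        exact congrArg _ (Finset.sum_congr rfl fun i _ => by ring)
      map_smul' := fun r z => by
        ext v
        simp only [liouville_apply, smul_apply, PiLp.smul_apply, smul_eq_mul, RingHom.id_apply,
          Finset.mul_sum]
        exact Finset.sum_congr rfl fun i _ => by ring }

@[simp]
theorem liouvilleBilin_apply {m : ℕ} (z : Plane m) : liouvilleBilin m z = liouville m z := rfl

/-! ### Contact geometry of `H ds + λ` -/

/-- The 1-form `H ds + λ`. -/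
def hamForm {L : ℝ} {m : ℕ} (H : Tube L m → ℝ) : OneForm L m := fun x =>
  H x • ContinuousLinearMap.fst ℝ ℝ (Plane m)
    + (liouville m x.2).comp (ContinuousLinearMap.snd ℝ ℝ (Plane m))

theorem hamForm_apply {L : ℝ} {m : ℕ} (H : Tube L m → ℝ) (x : Tube L m) (v : TubeVec m) :
    hamForm H x v = H x * v.1 + liouville m x.2 v.2 := by
  simp [hamForm]

theorem hamForm_eq_stdForm {L : ℝ} {m : ℕ} {H : Tube L m → ℝ} {x : Tube L m} (h : H x = 1) :
    hamForm H x = stdForm L m x := by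
  simp [hamForm, stdForm, h]

section Derivative

variable {L : ℝ} {m : ℕ} {H : Tube L m → ℝ} {x : Tube L m} {D : TubeVec m →L[ℝ] ℝ}

/-- The derivative of the coefficients of `H ds + λ`. -/
def hamFormDeriv (D : TubeVec m →L[ℝ] ℝ) : TubeVec m →L[ℝ] TubeVec m →L[ℝ] ℝ :=
  D.smulRight (ContinuousLinearMap.fst ℝ ℝ (Plane m))
    + (liouvilleBilin m).bilinearComp (ContinuousLinearMap.snd ℝ ℝ (Plane m))
        (ContinuousLinearMap.snd ℝ ℝ (Plane m))

theorem hasFDerivAt_hamForm (hD : HasFDerivAt (fun p => H (x + cover L m p)) D 0) :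
    HasFDerivAt (fun p => hamForm H (x + cover L m p)) (hamFormDeriv D) 0 := by
  have h1 := hD.smul_const (ContinuousLinearMap.fst ℝ ℝ (Plane m))
  set B := (liouvilleBilin m).bilinearComp (ContinuousLinearMap.snd ℝ ℝ (Plane m))
    (ContinuousLinearMap.snd ℝ ℝ (Plane m)) with hB
  have h2 : HasFDerivAt (fun p : TubeVec m => B (0, x.2) + B p) B 0 :=
    B.hasFDerivAt.const_add _
  refine (h1.add h2).congr_of_eventuallyEq (Eventually.of_forall fun p => ?_)
  refine ContinuousLinearMap.ext fun v => ?_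
  rw [hamForm_apply]
  simp only [Pi.add_apply, add_apply, smul_apply, smul_eq_mul, hB,
    ContinuousLinearMap.bilinearComp_apply, ContinuousLinearMap.coe_fst',
    ContinuousLinearMap.coe_snd', liouvilleBilin_apply, Prod.snd_add, cover]
  rw [← liouvilleBilin_apply, map_add]
  rfl

/-- `d(H ds + λ)` as a bilinear form. -/
def hamCurvature (D : TubeVec m →L[ℝ] ℝ) : TubeVec m →L[ℝ] TubeVec m →L[ℝ] ℝ :=
  hamFormDeriv D - (hamFormDeriv D).flip

theorem hamCurvature_apply (D : TubeVec m →L[ℝ] ℝ) (u v : TubeVec m) :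
    hamCurvature D u v = 2 * liouville m u.2 v.2 + D u * v.1 - D v * u.1 := by
  simp only [hamCurvature, hamFormDeriv, sub_apply, add_apply,
    ContinuousLinearMap.smulRight_apply, ContinuousLinearMap.bilinearComp_apply,
    ContinuousLinearMap.flip_apply, smul_apply, liouvilleBilin_apply, smul_eq_mul,
    ContinuousLinearMap.coe_fst', ContinuousLinearMap.coe_snd']
  rw [liouville_swap v.2 u.2]
  ring

theorem dForm_hamForm (hD : HasFDerivAt (fun p => H (x + cover L m p)) D 0) (u v : TubeVec m) :
    dForm (hamForm H) x ![u, v] = hamCurvature D u v := by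
  rw [dForm_apply, (hasFDerivAt_hamForm hD).fderiv]
  rfl

/-- The Hamiltonian vector of the restriction of `D` to the ball directions. -/
def hamVector (D : TubeVec m →L[ℝ] ℝ) : Plane m :=
  sgrad (D.comp (ContinuousLinearMap.inr ℝ ℝ (Plane m)))

theorem two_mul_liouville_hamVector (D : TubeVec m →L[ℝ] ℝ) (w : Plane m) :
    2 * liouville m (hamVector D) w = D (0, w) := by
  rw [hamVector, two_mul_liouville_sgrad]
  simp

theorem apply_hamVector (D : TubeVec m →L[ℝ] ℝ) : D (0, hamVector D) = 0 := by
  rw [← two_mul_liouville_hamVector, liouville_self, mul_zero]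

theorem apply_eq_fst_add_snd (D : TubeVec m →L[ℝ] ℝ) (w : TubeVec m) :
    D w = w.1 * D (1, 0) + D (0, w.2) := by
  rw [← smul_eq_mul, ← map_smul, ← map_add]
  simp

/-- The `s`-derivative of `H` cancels, because `D` vanishes on its own Hamiltonian vector. -/
theorem hamCurvature_hamVector (D : TubeVec m →L[ℝ] ℝ) (w : TubeVec m) :
    hamCurvature D (1, hamVector D) w = 0 := by
  rw [hamCurvature_apply, two_mul_liouville_hamVector, apply_eq_fst_add_snd D (1, _),
    apply_hamVector, apply_eq_fst_add_snd D w]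
  ring

theorem hamForm_hamVector (D : TubeVec m →L[ℝ] ℝ) :
    hamForm H x (1, hamVector D) = H x - 1 / 2 * D (0, x.2) := by
  rw [hamForm_apply, ← two_mul_liouville_hamVector, liouville_swap x.2]
  ring

theorem volDensity_hamForm (hD : HasFDerivAt (fun p => H (x + cover L m p)) D 0) :
    volDensity (hamForm H) x = symplecticConst m * (H x - 1 / 2 * D (0, x.2)) := by
  rw [volDensity, topForm_frame (dForm_hamForm hD) (X := hamVector D), hamForm_hamVector]
  · intro z w
    simp [hamCurvature_apply]
  · exact hamCurvature_hamVector D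
  · intro w
    have : hamCurvature D w (1, hamVector D) = - hamCurvature D (1, hamVector D) w := by
      rw [hamCurvature, sub_apply, sub_apply, sub_apply, sub_apply,
        ContinuousLinearMap.flip_apply, ContinuousLinearMap.flip_apply, neg_sub]
    rw [this, hamCurvature_hamVector, neg_zero]

/-- Nondegeneracy in the ball directions forces `v` to be a multiple of `(1, hamVector D)`, and
`β(v) = 1` fixes the factor. -/
theorem isReebVector_hamForm_iff (hD : HasFDerivAt (fun p => H (x + cover L m p)) D 0)
    (hne : H x - 1 / 2 * D (0, x.2) ≠ 0) (v : TubeVec m) :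
    IsReebVector (hamForm H) x v ↔
      v = (H x - 1 / 2 * D (0, x.2))⁻¹ • ((1 : ℝ), hamVector D) := by
  constructor
  · rintro ⟨h1, h2⟩
    have hv : v = v.1 • ((1 : ℝ), hamVector D) := by
      ext1
      · simp
      · refine eq_of_liouville_eq fun w => ?_
        have := h2 (0, w)
        rw [dForm_hamForm hD, hamCurvature_apply] at this
        have h3 : liouville m (v.1 • hamVector D) w = v.1 * liouville m (hamVector D) w := by
          rw [← liouvilleBilin_apply, map_smul]
          simp
        have h4 := two_mul_liouville_hamVector D w
        simp only [mul_zero, add_zero] at this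
        simp only [Prod.smul_snd, h3]
        linear_combination (1 / 2 : ℝ) * this - v.1 / 2 * h4
    rw [hv, map_smul, hamForm_hamVector, smul_eq_mul] at h1
    rw [hv, eq_inv_of_mul_eq_one_left h1]
  · rintro rfl
    refine ⟨?_, fun w => ?_⟩
    · rw [map_smul, hamForm_hamVector, smul_eq_mul, inv_mul_cancel₀ hne]
    · rw [dForm_hamForm hD, map_smul, smul_apply, hamCurvature_hamVector, smul_zero]

end Derivative

/-! ### Complete flows, lifts to the covering, and roots of loops -/

theorem exists_hasDerivAt_of_lipschitz_of_bounded {E : Type*} [NormedAddCommGroup E]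
    [NormedSpace ℝ E] [CompleteSpace E] {v : E → E} {K : NNReal} (hv : LipschitzWith K v)
    {M : ℝ} (hM : ∀ x, ‖v x‖ ≤ M) (x : E) :
    ∃ c : ℝ → E, c 0 = x ∧ ∀ t, HasDerivAt c (v (c t)) t := by
  have hM0 : 0 ≤ M := (norm_nonneg _).trans (hM x)
  have hloc : ∀ n : ℕ, ∃ c : ℝ → E, c 0 = x ∧
      ∀ t ∈ Ioo (-(n : ℝ)) n, HasDerivAt c (v (c t)) t := by
    intro n
    have hn : (0 : ℝ) ≤ n := n.cast_nonneg
    -- With speed at most `M`, a solution cannot leave the ball of radius `M * n` within time `n`;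
    -- this allows arbitrarily long time intervals.
    have hpl : IsPicardLindelof (fun _ => v) (tmin := -(n : ℝ)) (tmax := n)
        ⟨0, by simp⟩ x (⟨M, hM0⟩ * n) 0 ⟨M, hM0⟩ K :=
      { lipschitzOnWith := fun _ _ => hv.lipschitzOnWith
        continuousOn := fun _ _ => continuousOn_const
        norm_le := fun _ _ y _ => hM y
        mul_max_le := by
          simp only [sub_zero, zero_sub, neg_neg, max_self, NNReal.coe_zero]
          exact le_rfl }
    obtain ⟨c, h0, hc⟩ := hpl.exists_eq_forall_mem_Icc_hasDerivWithinAt₀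
    exact ⟨c, h0, fun t ht => (hc t (Ioo_subset_Icc_self ht)).hasDerivAt (Icc_mem_nhds ht.1 ht.2)⟩
  choose c h0 hc using hloc
  have heq : ∀ (k n : ℕ), k ≤ n → ∀ t ∈ Ioo (-(k : ℝ)) k, c k t = c n t := by
    intro k n hkn t ht
    have hkn' : (k : ℝ) ≤ n := by exact_mod_cast hkn
    have hk : (0 : ℝ) < k := by linarith [ht.1, ht.2]
    refine ODE_solution_unique_of_mem_Ioo (v := fun _ => v) (s := fun _ => univ) (K := K)
      (t₀ := 0) (fun _ _ => hv.lipschitzOnWith) ⟨by linarith, hk⟩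
      (fun s hs => ⟨hc k s hs, trivial⟩) (fun s hs => ⟨hc n s ?_, trivial⟩) ?_ ht
    · exact ⟨by linarith [hs.1], by linarith [hs.2]⟩
    · rw [h0, h0]
  have hmem : ∀ t : ℝ, t ∈ Ioo (-((⌈|t|⌉₊ + 1 : ℕ) : ℝ)) (⌈|t|⌉₊ + 1 : ℕ) := by
    intro t
    have := Nat.le_ceil |t|
    rw [mem_Ioo, ← abs_lt]
    push_cast
    linarith
  refine ⟨fun t => c (⌈|t|⌉₊ + 1) t, h0 _, fun t => ?_⟩
  have hev : (fun s => c (⌈|s|⌉₊ + 1) s) =ᶠ[𝓝 t] c (⌈|t|⌉₊ + 1) := by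
    filter_upwards [isOpen_Ioo.mem_nhds (hmem t)] with s hs
    rcases le_total (⌈|s|⌉₊ + 1) (⌈|t|⌉₊ + 1) with h | h
    · exact heq _ _ h s (hmem s)
    · exact (heq _ _ h s hs).symm
  exact (hc _ t (hmem t)).congr_of_eventuallyEq hev

theorem exists_bound_of_periodic {m : ℕ} {F : Type*} [NormedAddCommGroup F] {L : ℝ} (hL : 0 < L)
    {Φ : TubeVec m → F} (hc : Continuous Φ) (hper : ∀ p, Φ (p + (L, 0)) = Φ p) {a : F}
    (ha : ∀ p, 1 ≤ ‖p.2‖ → Φ p = a) : ∃ M, ∀ p, ‖Φ p‖ ≤ M := by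
  obtain ⟨M, hM⟩ := (isCompact_Icc.prod
    (isCompact_closedBall (0 : Plane m) 1)).exists_bound_of_continuousOn
    (hc.continuousOn (s := Icc 0 L ×ˢ Metric.closedBall (0 : Plane m) 1))
  refine ⟨max M ‖a‖, fun p => ?_⟩
  rcases le_total 1 ‖p.2‖ with h | h
  · rw [ha p h]
    exact le_max_right _ _
  · refine le_trans ?_ (le_max_left _ _)
    have hP : Function.Periodic (fun s : ℝ => Φ (s, p.2)) L := fun s => by
      simpa using hper (s, p.2)
    obtain ⟨s, hs, he⟩ := hP.exists_mem_Ico₀ hL p.1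
    rw [show p = (p.1, p.2) from rfl, he]
    exact hM _ ⟨Ico_subset_Icc_self hs, by simpa using h⟩

/-- The velocity is given by unrelated local lifts, but its `s`-component is globally continuous.
Integrating it gives a candidate for the lift, whose difference from `γ` in the circle has zero
derivative. -/
theorem exists_lift {L : ℝ} [Fact (0 < L)] {m : ℕ} {γ : ℝ → Tube L m} {w : ℝ → TubeVec m}
    (hγ : ∀ t, HasVelocityAt γ (w t) t) (hw : Continuous fun t => (w t).1) :
    ∃ c : ℝ → TubeVec m, (∀ t, cover L m (c t) = γ t) ∧ ∀ t, HasDerivAt c (w t) t := by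
  obtain ⟨s₀, hs₀⟩ := QuotientAddGroup.mk_surjective (γ 0).1
  set s : ℝ → ℝ := fun t => s₀ + ∫ τ in (0 : ℝ)..t, (w τ).1 with hs
  have hsd : ∀ t, HasDerivAt s (w t).1 t := fun t =>
    (intervalIntegral.integral_hasDerivAt_right (hw.intervalIntegrable _ _)
      (hw.stronglyMeasurableAtFilter _ _) hw.continuousAt).const_add s₀
  set d : ℝ → ℂ := fun t =>
    (AddCircle.toCircle ((γ t).1 - (s t : AddCircle L)) : ℂ) with hd
  have hdd : ∀ t, HasDerivAt d 0 t := by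
    intro t
    obtain ⟨c, hc, hcd⟩ := hγ t
    have h1 : HasDerivAt (fun τ => (c τ).1 - s τ) 0 t := by
      have hf : HasDerivAt (fun τ => (c τ).1) (w t).1 t :=
        (ContinuousLinearMap.fst ℝ ℝ (Plane m)).hasFDerivAt.comp_hasDerivAt t hcd
      have hsub := hf.sub (hsd t)
      rw [sub_self] at hsub
      exact hsub
    have h2 : HasDerivAt (fun τ => Complex.exp (((2 * Real.pi / L * ((c τ).1 - s τ) : ℝ) : ℂ)
        * Complex.I)) 0 t := by
      simpa using ((h1.const_mul (2 * Real.pi / L)).ofReal_comp.mul_const Complex.I).cexp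
    refine h2.congr_of_eventuallyEq ?_
    filter_upwards [hc] with τ hτ
    simp only [hd, ← hτ, cover]
    rw [← AddCircle.coe_sub, AddCircle.toCircle_apply_mk, Circle.coe_exp]
  have hdc : ∀ t, d t = 1 := by
    intro t
    rw [is_const_of_deriv_eq_zero (fun t => (hdd t).differentiableAt) (fun t => (hdd t).deriv) t 0]
    simp only [hd, hs, intervalIntegral.integral_same, add_zero]
    rw [← hs₀]
    change ((AddCircle.toCircle ((s₀ : AddCircle L) - (s₀ : AddCircle L))) : ℂ) = 1
    simp
  refine ⟨fun t => (s t, (γ t).2), fun t => ?_, fun t => ?_⟩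
  · refine Prod.ext ?_ rfl
    have h1 := hdc t
    simp only [hd] at h1
    have h2 : AddCircle.toCircle ((γ t).1 - (s t : AddCircle L))
        = AddCircle.toCircle (0 : AddCircle L) := by
      rw [AddCircle.toCircle_zero]
      exact Circle.ext h1
    exact (sub_eq_zero.1 (AddCircle.injective_toCircle (Fact.out : 0 < L).ne' h2)).symm
  · obtain ⟨c, hc, hcd⟩ := hγ t
    have h2 : HasDerivAt (fun τ => (γ τ).2) (w t).2 t := by
      have hf : HasDerivAt (fun τ => (c τ).2) (w t).2 t :=
        (ContinuousLinearMap.snd ℝ ℝ (Plane m)).hasFDerivAt.comp_hasDerivAt t hcd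
      refine hf.congr_of_eventuallyEq ?_
      filter_upwards [hc] with τ hτ
      rw [← hτ]
      rfl
    exact (hsd t).prodMk h2

theorem HasVelocityAt.continuousAt {L : ℝ} {m : ℕ} {γ : ℝ → Tube L m} {v : TubeVec m} {t : ℝ}
    (h : HasVelocityAt γ v t) : ContinuousAt γ t := by
  obtain ⟨c, hc, hcd⟩ := h
  have hcov : Continuous (cover L m) :=
    ((AddCircle.continuous_mk' L).comp continuous_fst).prodMk continuous_snd
  exact (hcov.continuousAt.comp hcd.continuousAt).congr hc

/-- A continuous branch of an `N`-th root of a loop in the slit plane closes up. -/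
theorem root_eq_of_slitPlane {N : ℕ} (hN : N ≠ 0) {u V : ℝ → ℂ} (hu : Continuous u)
    (hV : Continuous V) (huV : ∀ t, u t ^ N = V t) (hs : ∀ t, V t ∈ Complex.slitPlane)
    {a b : ℝ} (hab : V a = V b) : u a = u b := by
  set w : ℝ → ℂ := fun t => V t ^ ((N : ℂ)⁻¹) with hw
  have hwc : Continuous w := hV.cpow continuous_const hs
  have hwN : ∀ t, w t ^ N = V t := fun t => Complex.cpow_nat_inv_pow _ hN
  have hw0 : ∀ t, w t ≠ 0 := fun t h => by
    have := hwN t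
    rw [h, zero_pow hN] at this
    exact Complex.slitPlane_ne_zero (hs t) this.symm
  have hfin : {q : ℂ | q ^ N = 1}.Finite := by
    refine (Polynomial.nthRootsFinset N (1 : ℂ)).finite_toSet.subset fun q hq => ?_
    simpa [Polynomial.mem_nthRootsFinset (Nat.pos_of_ne_zero hN)] using hq
  -- The quotient by the principal root is a continuous map from the line to the finite set of
  -- `N`-th roots of unity, hence constant.
  have hq : u a / w a = u b / w b :=
    isPreconnected_univ.constant_of_mapsTo hfin.isDiscrete
      (f := fun t => u t / w t) (hu.div hwc hw0).continuousOn
      (fun t _ => by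
        simp only [mem_ofPred_eq, div_pow, huV, hwN]
        exact div_self (Complex.slitPlane_ne_zero (hs t))) (mem_univ a) (mem_univ b)
  have hwab : w a = w b := by simp [hw, hab]
  rw [hwab] at hq
  exact (div_left_inj' (hw0 b)).1 hq

/-! ### The radial cutoff profile -/

/-- A smooth convex function that vanishes on `(-∞, 0]` and has slope `1` on `[1, ∞)`. -/
def ramp (x : ℝ) : ℝ := ∫ t in (0 : ℝ)..x, Real.smoothTransition t

theorem hasDerivAt_ramp (x : ℝ) : HasDerivAt ramp (Real.smoothTransition x) x :=
  intervalIntegral.integral_hasDerivAt_right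
    (Real.smoothTransition.continuous.intervalIntegrable _ _)
    (Real.smoothTransition.continuous.stronglyMeasurableAtFilter _ _)
    Real.smoothTransition.continuous.continuousAt

theorem contDiff_ramp : ContDiff ℝ ∞ ramp := by
  rw [contDiff_infty_iff_deriv]
  refine ⟨fun x => (hasDerivAt_ramp x).differentiableAt, ?_⟩
  rw [show deriv ramp = Real.smoothTransition from funext fun x => (hasDerivAt_ramp x).deriv]
  exact Real.smoothTransition.contDiff

theorem monotone_ramp : Monotone ramp :=
  monotone_of_deriv_nonneg (fun x => (hasDerivAt_ramp x).differentiableAt) fun x => by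
    rw [(hasDerivAt_ramp x).deriv]
    exact Real.smoothTransition.nonneg x

theorem ramp_zero : ramp 0 = 0 := by simp [ramp]

theorem ramp_of_nonpos {x : ℝ} (h : x ≤ 0) : ramp x = 0 := by
  rw [ramp, intervalIntegral.integral_congr (g := fun _ => 0)]
  · simp
  · intro t ht
    rw [uIcc_of_ge h] at ht
    exact Real.smoothTransition.zero_of_nonpos ht.2

theorem ramp_nonneg (x : ℝ) : 0 ≤ ramp x := by
  rcases le_total x 0 with h | h
  · rw [ramp_of_nonpos h]
  · rw [← ramp_zero]
    exact monotone_ramp h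

theorem strictMonoOn_ramp : StrictMonoOn ramp (Ici 0) := by
  refine strictMonoOn_of_deriv_pos (convex_Ici 0) contDiff_ramp.continuous.continuousOn ?_
  intro x hx
  rw [interior_Ici] at hx
  rw [(hasDerivAt_ramp x).deriv]
  exact Real.smoothTransition.pos_of_pos hx

theorem ramp_pos {x : ℝ} (h : 0 < x) : 0 < ramp x := by
  rw [← ramp_zero]
  exact strictMonoOn_ramp self_mem_Ici h.le h

theorem monotone_sub_ramp : Monotone fun x => x - ramp x := by
  have hd : ∀ x, HasDerivAt (fun x => x - ramp x) (1 - Real.smoothTransition x) x := fun x =>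
    (hasDerivAt_id x).sub (hasDerivAt_ramp x)
  refine monotone_of_deriv_nonneg (fun x => (hd x).differentiableAt) fun x => ?_
  rw [(hd x).deriv]
  exact sub_nonneg.2 (Real.smoothTransition.le_one x)

theorem ramp_le {x : ℝ} (h : 0 ≤ x) : ramp x ≤ x := by
  have := monotone_sub_ramp h
  simp only [ramp_zero] at this
  linarith

theorem sub_one_le_ramp (x : ℝ) : x - 1 ≤ ramp x := by
  rcases le_total x 1 with h | h
  · linarith [ramp_nonneg x]
  · have key := (convex_Icc 1 x).mul_sub_le_image_sub_of_le_deriv (f := ramp) (C := 1)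
      contDiff_ramp.continuous.continuousOn
      (fun y _ => (hasDerivAt_ramp y).differentiableAt.differentiableWithinAt)
      (fun y hy => by
        rw [interior_Icc] at hy
        rw [(hasDerivAt_ramp y).deriv, Real.smoothTransition.one_of_one_le hy.1.le])
      1 ⟨le_rfl, h⟩ x ⟨h, le_rfl⟩ h
    linarith [ramp_nonneg 1]

/-- The function `ρ ↦ ramp (N (1 - ρ) - c) / N`, a smoothing of `max (1 - c / N - ρ) 0`. -/
def cap (N : ℕ) (c ρ : ℝ) : ℝ := ramp (N * (1 - ρ) - c) / N

/-- Minus the slope of `cap`. -/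
def capSlope (N : ℕ) (c ρ : ℝ) : ℝ := Real.smoothTransition (N * (1 - ρ) - c)

section Cap

variable {N : ℕ} {c ρ : ℝ}

theorem hasDerivAt_cap (hN : N ≠ 0) : HasDerivAt (cap N c) (- capSlope N c ρ) ρ := by
  have hN' : (N : ℝ) ≠ 0 := Nat.cast_ne_zero.2 hN
  have h1 : HasDerivAt (fun ρ : ℝ => (N : ℝ) * (1 - ρ) - c) (-N) ρ := by
    simpa using (((hasDerivAt_id ρ).const_sub 1).const_mul (N : ℝ)).sub_const c
  have h2 := ((hasDerivAt_ramp _).comp ρ h1).div_const (N : ℝ)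
  refine h2.congr_deriv ?_
  rw [capSlope]
  field_simp

theorem contDiff_cap (N : ℕ) (c : ℝ) : ContDiff ℝ ∞ (cap N c) :=
  (contDiff_ramp.comp ((contDiff_const.mul (contDiff_const.sub contDiff_id)).sub
    contDiff_const)).div_const _

theorem cap_nonneg : 0 ≤ cap N c ρ := div_nonneg (ramp_nonneg _) N.cast_nonneg

theorem capSlope_nonneg : 0 ≤ capSlope N c ρ := Real.smoothTransition.nonneg _

theorem capSlope_le_one : capSlope N c ρ ≤ 1 := Real.smoothTransition.le_one _

theorem cap_eq_zero (h : N * (1 - ρ) ≤ c) : cap N c ρ = 0 := by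
  rw [cap, ramp_of_nonpos (by linarith), zero_div]

theorem capSlope_eq_zero (h : N * (1 - ρ) ≤ c) : capSlope N c ρ = 0 :=
  Real.smoothTransition.zero_of_nonpos (by linarith)

theorem capSlope_eq_one (h : c + 1 ≤ N * (1 - ρ)) : capSlope N c ρ = 1 :=
  Real.smoothTransition.one_of_one_le (by linarith)

theorem cap_pos (hN : N ≠ 0) (h : c < N * (1 - ρ)) : 0 < cap N c ρ :=
  div_pos (ramp_pos (by linarith)) (by positivity)

/-- The intercept at `0` of the tangent of `cap` is at most the zero of the linear part. -/
theorem cap_add_mul_capSlope_le (hN : N ≠ 0) (hc : c ≤ N) (hρ : 0 ≤ ρ) :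
    cap N c ρ + ρ * capSlope N c ρ ≤ 1 - c / N := by
  have hN' : (0 : ℝ) < N := by positivity
  have hR : 0 ≤ 1 - c / N := sub_nonneg.2 ((div_le_one hN').2 hc)
  rcases le_total ((N : ℝ) * (1 - ρ)) c with h | h
  · rw [cap_eq_zero h, capSlope_eq_zero h]
    simpa using hR
  · have h1 : cap N c ρ ≤ (N * (1 - ρ) - c) / N :=
      div_le_div_of_nonneg_right (ramp_le (by linarith)) hN'.le
    have h2 : (N * (1 - ρ) - c) / N = 1 - ρ - c / N := by field_simp
    have h3 : ρ * capSlope N c ρ ≤ ρ * 1 := mul_le_mul_of_nonneg_left capSlope_le_one hρ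
    linarith

/-- Matches `cap_add_mul_capSlope_le` up to `1 / N` on the linear part; this gap is what remains of
the density in the limit of large `N`, beside other terms of order `1 / N`. -/
theorem le_cap_add_mul_capSlope (hN : N ≠ 0) (h : c + 1 ≤ N * (1 - ρ)) :
    1 - (c + 1) / N ≤ cap N c ρ + ρ * capSlope N c ρ := by
  have hN' : (0 : ℝ) < N := by positivity
  have h1 : (N * (1 - ρ) - c - 1) / N ≤ cap N c ρ :=
    div_le_div_of_nonneg_right (sub_one_le_ramp _) hN'.le
  have h2 : (N * (1 - ρ) - c - 1) / N = 1 - ρ - (c + 1) / N := by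
    field_simp
    ring
  rw [capSlope_eq_one h]
  linarith

end Cap

/-! ### The Hamiltonian of the plug and its first integral -/

/-- The complex coordinate `x_i + √-1 y_i`. -/
def zcoord {m : ℕ} (i : Fin m) : Plane m →L[ℝ] ℂ :=
  Complex.ofRealCLM.comp (EuclideanSpace.proj (i, 0))
    + Complex.I • Complex.ofRealCLM.comp (EuclideanSpace.proj (i, 1))

theorem zcoord_apply {m : ℕ} (i : Fin m) (z : Plane m) :
    zcoord i z = z (i, 0) + Complex.I * z (i, 1) := by
  simp [zcoord]

/-- The standard complex structure. -/
def rot {m : ℕ} (z : Plane m) : Plane m :=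
  WithLp.toLp 2 fun j => if j.2 = 0 then - z (j.1, 1) else z (j.1, 0)

theorem zcoord_rot {m : ℕ} (i : Fin m) (z : Plane m) :
    zcoord i (rot z) = Complex.I * zcoord i z := by
  simp only [zcoord_apply, rot]
  simp
  linear_combination (-(z (i, 1) : ℂ)) * Complex.I_mul_I

theorem two_mul_liouville_rot {m : ℕ} (z w : Plane m) :
    2 * liouville m (rot z) w = - inner ℝ z w := by
  rw [liouville_apply, PiLp.inner_apply, Fintype.sum_prod_type, ← mul_assoc,
    ← Finset.sum_neg_distrib]
  rw [show (2 : ℝ) * (1 / 2) = 1 by norm_num, one_mul]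
  refine Finset.sum_congr rfl fun i _ => ?_
  simp [rot, Fin.sum_univ_two]
  ring

theorem inner_rot {m : ℕ} (z : Plane m) : inner ℝ z (rot z) = 0 := by
  have h := two_mul_liouville_rot z (rot z)
  rw [liouville_self] at h
  linarith

/-- The function `e^{-2πis/L} ζ^N` of the universal covering. -/
def phase (L : ℝ) {m : ℕ} (i : Fin m) (N : ℕ) (p : TubeVec m) : ℂ :=
  Complex.exp (((2 * Real.pi / L * (-p.1) : ℝ) : ℂ) * Complex.I) * zcoord i p.2 ^ N

/-- The function `e^{-2πis/L} ζ^N`. -/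
def circlePhase (L : ℝ) {m : ℕ} (i : Fin m) (N : ℕ) (x : Tube L m) : ℂ :=
  (AddCircle.toCircle (-x.1) : ℂ) * zcoord i x.2 ^ N

theorem circlePhase_cover (L : ℝ) {m : ℕ} (i : Fin m) (N : ℕ) (p : TubeVec m) :
    circlePhase L i N (cover L m p) = phase L i N p := by
  simp only [circlePhase, phase, cover]
  rw [← AddCircle.coe_neg, AddCircle.toCircle_apply_mk, Circle.coe_exp]

/-- The derivative of `phase`. -/
def phaseDeriv (L : ℝ) {m : ℕ} (i : Fin m) (N : ℕ) (p : TubeVec m) : TubeVec m →L[ℝ] ℂ :=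
  (phase L i N p * (-(2 * Real.pi / L : ℝ) * Complex.I)) •
      Complex.ofRealCLM.comp (ContinuousLinearMap.fst ℝ ℝ (Plane m))
    + (Complex.exp (((2 * Real.pi / L * (-p.1) : ℝ) : ℂ) * Complex.I) *
        (N * zcoord i p.2 ^ (N - 1))) •
      (zcoord i).comp (ContinuousLinearMap.snd ℝ ℝ (Plane m))

theorem hasFDerivAt_phase (L : ℝ) {m : ℕ} (i : Fin m) (N : ℕ) (p : TubeVec m) :
    HasFDerivAt (phase L i N) (phaseDeriv L i N p) p := by
  have h1 : HasFDerivAt (fun p : TubeVec m =>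
      Complex.exp (((2 * Real.pi / L * (-p.1) : ℝ) : ℂ) * Complex.I)) _ p :=
    ((Complex.ofRealCLM.hasFDerivAt.comp p
      ((hasFDerivAt_fst (𝕜 := ℝ) (p := p)).neg.const_mul (2 * Real.pi / L))).mul_const
      Complex.I).cexp
  have h2 : HasFDerivAt (fun p : TubeVec m => zcoord i p.2 ^ N) _ p :=
    (((zcoord i).hasFDerivAt.comp p (hasFDerivAt_snd (𝕜 := ℝ) (p := p))).pow N)
  refine (h1.mul h2).congr_fderiv ?_
  refine ContinuousLinearMap.ext fun v => ?_
  simp [phaseDeriv, phase]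
  ring

theorem contDiff_phase (L : ℝ) {m : ℕ} (i : Fin m) (N : ℕ) :
    ContDiff ℝ ∞ (phase (m := m) L i N) := by
  unfold phase
  refine ContDiff.mul ?_ (((zcoord i).contDiff.comp contDiff_snd).pow N)
  exact ((Complex.ofRealCLM.contDiff.comp (contDiff_const.mul contDiff_fst.neg)).mul
    contDiff_const).cexp

/-- Euler's identity for a function homogeneous of degree `N` in `z`. It produces the factor `N` in
the last term of `plugDensityVal`. -/
theorem phaseDeriv_radial (L : ℝ) {m : ℕ} (i : Fin m) {N : ℕ} (hN : N ≠ 0) (p : TubeVec m) :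
    phaseDeriv L i N p (0, p.2) = N * phase L i N p := by
  obtain ⟨n, rfl⟩ := Nat.exists_eq_succ_of_ne_zero hN
  simp [phaseDeriv, phase, pow_succ]
  ring

/-- Rotating `ζ` at speed `2π/(NL)` turns `ζ^N` at speed `2π/L`, which the factor `e^{-2πis/L}`
undoes. -/
theorem phaseDeriv_rot (L : ℝ) {m : ℕ} (i : Fin m) {N : ℕ} (hN : N ≠ 0) (p : TubeVec m) :
    phaseDeriv L i N p (1, (2 * Real.pi / (N * L)) • rot p.2) = 0 := by
  have hN' : (N : ℂ) ≠ 0 := Nat.cast_ne_zero.2 hN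
  obtain ⟨n, rfl⟩ := Nat.exists_eq_succ_of_ne_zero hN
  simp [phaseDeriv, phase, zcoord_rot]
  field_simp
  simp
  exact Or.inl (by ring)

/-- The Hamiltonian of the plug as a function of `a = (Im (e^{-2πis/L} ζ^N))^2` and `ρ = |z|^2`. -/
def plugHamVal (L : ℝ) (N : ℕ) (κ a ρ : ℝ) : ℝ :=
  1 + Real.pi / (N * L) * cap N 1 ρ - a / (a + κ) * cap N 2 ρ

/-- The density of the plug as a function of `a = (Im (e^{-2πis/L} ζ^N))^2` and `ρ = |z|^2`. -/
def plugDensityVal (L : ℝ) (N : ℕ) (κ a ρ : ℝ) : ℝ :=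
  1 + Real.pi / (N * L) * (cap N 1 ρ + ρ * capSlope N 1 ρ)
    - a / (a + κ) * (cap N 2 ρ + ρ * capSlope N 2 ρ) + N * (a * κ) / (a + κ) ^ 2 * cap N 2 ρ

/-- The Hamiltonian of the plug. -/
def plugHam (L : ℝ) {m : ℕ} (i : Fin m) (N : ℕ) (κ : ℝ) (x : Tube L m) : ℝ :=
  plugHamVal L N κ ((circlePhase L i N x).im ^ 2) (‖x.2‖ ^ 2)

/-- The Hamiltonian of the plug on the universal covering. -/
def plugHamLift (L : ℝ) {m : ℕ} (i : Fin m) (N : ℕ) (κ : ℝ) (p : TubeVec m) : ℝ :=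
  plugHamVal L N κ ((phase L i N p).im ^ 2) (‖p.2‖ ^ 2)

/-- The density of the plug. -/
def plugDensity (L : ℝ) {m : ℕ} (i : Fin m) (N : ℕ) (κ : ℝ) (x : Tube L m) : ℝ :=
  plugDensityVal L N κ ((circlePhase L i N x).im ^ 2) (‖x.2‖ ^ 2)

/-- The differential of `|z|^2`. -/
def normSqDeriv {m : ℕ} (p : TubeVec m) : TubeVec m →L[ℝ] ℝ :=
  (2 : ℝ) • (innerSL ℝ p.2).comp (ContinuousLinearMap.snd ℝ ℝ (Plane m))

/-- The differential of `(Im (e^{-2πis/L} ζ^N))^2`. -/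
def imSqDeriv (L : ℝ) {m : ℕ} (i : Fin m) (N : ℕ) (p : TubeVec m) : TubeVec m →L[ℝ] ℝ :=
  (2 * (phase L i N p).im) • Complex.imCLM.comp (phaseDeriv L i N p)

/-- The differential of the rotation part `π / (N L) * cap` of the Hamiltonian. -/
def rotationDeriv (L : ℝ) {m : ℕ} (N : ℕ) (p : TubeVec m) : TubeVec m →L[ℝ] ℝ :=
  (-(Real.pi / (N * L) * capSlope N 1 (‖p.2‖ ^ 2))) • normSqDeriv p

/-- The twisting part of the Hamiltonian. -/
def twist (L : ℝ) {m : ℕ} (i : Fin m) (N : ℕ) (κ : ℝ) (p : TubeVec m) : ℝ :=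
  (phase L i N p).im ^ 2 / ((phase L i N p).im ^ 2 + κ) * cap N 2 (‖p.2‖ ^ 2)

/-- The differential of the twisting part of the Hamiltonian. -/
def twistDeriv (L : ℝ) {m : ℕ} (i : Fin m) (N : ℕ) (κ : ℝ) (p : TubeVec m) :
    TubeVec m →L[ℝ] ℝ :=
  (κ / ((phase L i N p).im ^ 2 + κ) ^ 2 * cap N 2 (‖p.2‖ ^ 2)) • imSqDeriv L i N p
    - ((phase L i N p).im ^ 2 / ((phase L i N p).im ^ 2 + κ) * capSlope N 2 (‖p.2‖ ^ 2)) •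
        normSqDeriv p

/-- The differential of `plugHamLift`. -/
def plugHamDeriv (L : ℝ) {m : ℕ} (i : Fin m) (N : ℕ) (κ : ℝ) (p : TubeVec m) :
    TubeVec m →L[ℝ] ℝ :=
  rotationDeriv L N p - twistDeriv L i N κ p

theorem normSqDeriv_apply {m : ℕ} (p v : TubeVec m) :
    normSqDeriv p v = 2 * inner ℝ p.2 v.2 := by
  simp [normSqDeriv]

theorem hasFDerivAt_normSq {m : ℕ} (p : TubeVec m) :
    HasFDerivAt (fun p : TubeVec m => ‖p.2‖ ^ 2) (normSqDeriv p) p := by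
  have h := (hasStrictFDerivAt_norm_sq p.2).hasFDerivAt.comp p (hasFDerivAt_snd (𝕜 := ℝ) (p := p))
  refine h.congr_fderiv ?_
  refine ContinuousLinearMap.ext fun v => ?_
  simp [normSqDeriv]

section Plug

variable {L : ℝ} {m : ℕ} {i : Fin m} {N : ℕ} {κ : ℝ}

theorem hasFDerivAt_imSq (p : TubeVec m) :
    HasFDerivAt (fun p => (phase L i N p).im ^ 2) (imSqDeriv L i N p) p := by
  have h := (Complex.imCLM.hasFDerivAt.comp p (hasFDerivAt_phase L i N p)).pow 2
  refine h.congr_fderiv ?_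
  refine ContinuousLinearMap.ext fun v => ?_
  simp [imSqDeriv]

theorem hasFDerivAt_cap (hN : N ≠ 0) (c : ℝ) (p : TubeVec m) :
    HasFDerivAt (fun p : TubeVec m => cap N c (‖p.2‖ ^ 2))
      (-capSlope N c (‖p.2‖ ^ 2) • normSqDeriv p) p :=
  (hasDerivAt_cap hN).comp_hasFDerivAt p (hasFDerivAt_normSq p)

theorem hasFDerivAt_twist (hN : N ≠ 0) (hκ : 0 < κ) (p : TubeVec m) :
    HasFDerivAt (twist L i N κ) (twistDeriv L i N κ p) p := by
  have hpos : (phase L i N p).im ^ 2 + κ ≠ 0 := by positivity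
  have h1 : HasDerivAt (fun a : ℝ => a / (a + κ)) (κ / ((phase L i N p).im ^ 2 + κ) ^ 2)
      ((phase L i N p).im ^ 2) := by
    refine ((hasDerivAt_id _).div ((hasDerivAt_id _).add_const κ) hpos).congr_deriv ?_
    simp
  have h2 := (h1.comp_hasFDerivAt p (hasFDerivAt_imSq p)).mul (hasFDerivAt_cap hN 2 p)
  refine h2.congr_fderiv ?_
  refine ContinuousLinearMap.ext fun v => ?_
  simp [twistDeriv]
  ring

theorem hasFDerivAt_plugHamLift (hN : N ≠ 0) (hκ : 0 < κ) (p : TubeVec m) :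
    HasFDerivAt (plugHamLift L i N κ) (plugHamDeriv L i N κ p) p := by
  have h := (((hasFDerivAt_cap hN 1 p).const_mul (Real.pi / (N * L))).const_add 1).sub
    (hasFDerivAt_twist (L := L) (i := i) hN hκ p)
  refine h.congr_fderiv ?_
  refine ContinuousLinearMap.ext fun v => ?_
  simp [plugHamDeriv, rotationDeriv]
  ring

theorem contDiff_plugHamLift (hκ : 0 < κ) : ContDiff ℝ ∞ (plugHamLift (m := m) L i N κ) := by
  have hn : ContDiff ℝ ∞ fun p : TubeVec m => ‖p.2‖ ^ 2 := contDiff_snd.norm_sq ℝ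
  have hc : ∀ c, ContDiff ℝ ∞ fun p : TubeVec m => cap N c (‖p.2‖ ^ 2) := fun c =>
    (contDiff_cap N c).comp hn
  have ha : ContDiff ℝ ∞ fun p : TubeVec m => (phase L i N p).im ^ 2 :=
    (Complex.imCLM.contDiff.comp (contDiff_phase L i N)).pow 2
  exact (contDiff_const.add (contDiff_const.mul (hc 1))).sub
    ((ha.div (ha.add contDiff_const) fun p => by positivity).mul (hc 2))

theorem plugHam_cover (p : TubeVec m) : plugHam L i N κ (cover L m p) = plugHamLift L i N κ p := by
  rw [plugHam, circlePhase_cover]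
  rfl

theorem plugDensity_cover (p : TubeVec m) : plugDensity L i N κ (cover L m p)
    = plugDensityVal L N κ ((phase L i N p).im ^ 2) (‖p.2‖ ^ 2) := by
  rw [plugDensity, circlePhase_cover]
  rfl

theorem cover_add (p q : TubeVec m) : cover L m (p + q) = cover L m p + cover L m q := by
  simp [cover]

theorem cover_surjective (x : Tube L m) : ∃ p, cover L m p = x := by
  obtain ⟨s, hs⟩ := QuotientAddGroup.mk_surjective x.1
  exact ⟨(s, x.2), Prod.ext hs rfl⟩

theorem hasFDerivAt_plugHam (hN : N ≠ 0) (hκ : 0 < κ) (p : TubeVec m) :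
    HasFDerivAt (fun q => plugHam L i N κ (cover L m p + cover L m q))
      (plugHamDeriv L i N κ p) 0 := by
  simp only [← cover_add, plugHam_cover]
  have h : HasFDerivAt (plugHamLift L i N κ) (plugHamDeriv L i N κ p) (p + 0) := by
    rw [add_zero]
    exact hasFDerivAt_plugHamLift hN hκ p
  have hadd : HasFDerivAt (fun q : TubeVec m => p + q) (ContinuousLinearMap.id ℝ (TubeVec m)) 0 :=
    (hasFDerivAt_id (0 : TubeVec m)).const_add p
  have hcomp := HasFDerivAt.comp (0 : TubeVec m) h hadd
  rw [ContinuousLinearMap.comp_id] at hcomp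
  exact hcomp

theorem imSqDeriv_radial (hN : N ≠ 0) (p : TubeVec m) :
    imSqDeriv L i N p (0, p.2) = 2 * N * (phase L i N p).im ^ 2 := by
  simp only [imSqDeriv, smul_apply, ContinuousLinearMap.comp_apply, phaseDeriv_radial L i hN,
    Complex.imCLM_apply, smul_eq_mul, Complex.mul_im, Complex.natCast_re, Complex.natCast_im]
  ring

theorem plugHamLift_sub_half_deriv (hN : N ≠ 0) (p : TubeVec m) :
    plugHamLift L i N κ p - 1 / 2 * plugHamDeriv L i N κ p (0, p.2)
      = plugDensity L i N κ (cover L m p) := by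
  rw [plugDensity_cover]
  simp only [plugHamDeriv, rotationDeriv, twistDeriv, sub_apply, smul_apply,
    imSqDeriv_radial hN, normSqDeriv_apply, real_inner_self_eq_norm_sq, smul_eq_mul,
    plugHamLift, plugHamVal, plugDensityVal]
  ring

theorem plugHam_sub_half_deriv (hN : N ≠ 0) (p : TubeVec m) :
    plugHam L i N κ (cover L m p) - 1 / 2 * plugHamDeriv L i N κ p (0, (cover L m p).2)
      = plugDensity L i N κ (cover L m p) := by
  rw [plugHam_cover]
  exact plugHamLift_sub_half_deriv hN p

/-- The coefficient `π/(NL)` in the Hamiltonian is chosen for this: where the slope is `1`, the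
speed is the one in `phaseDeriv_rot`. -/
theorem hamVector_rotationDeriv (p : TubeVec m) : hamVector (rotationDeriv L N p)
    = capSlope N 1 (‖p.2‖ ^ 2) • (2 * Real.pi / (N * L)) • rot p.2 := by
  refine eq_of_liouville_eq fun w => ?_
  have h1 := two_mul_liouville_hamVector (rotationDeriv L N p) w
  have h2 := two_mul_liouville_rot p.2 w
  rw [← liouvilleBilin_apply (_ • _ • _), map_smul, map_smul]
  simp only [smul_apply, liouvilleBilin_apply, smul_eq_mul]
  simp only [rotationDeriv, smul_apply, normSqDeriv_apply, smul_eq_mul] at h1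
  simp only [rotationDeriv] at h1 ⊢
  linear_combination (1 / 2 : ℝ) * h1 - (capSlope N 1 (‖p.2‖ ^ 2) * (Real.pi / (N * L))) * h2

theorem hamVector_sub (D D' : TubeVec m →L[ℝ] ℝ) :
    hamVector (D - D') = hamVector D - hamVector D' := by
  ext ⟨j, k⟩
  fin_cases k <;> simp [hamVector, sgrad]
  ring

theorem hamVector_zero : hamVector (0 : TubeVec m →L[ℝ] ℝ) = 0 := by
  have := hamVector_sub (0 : TubeVec m →L[ℝ] ℝ) 0
  rwa [sub_self, sub_self] at this

/-- The twisting part of the Hamiltonian is constant along the flow. -/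
theorem twistDeriv_hamVector (hN : N ≠ 0) (p : TubeVec m) :
    twistDeriv L i N κ p (1, hamVector (plugHamDeriv L i N κ p)) = 0 := by
  rw [plugHamDeriv, hamVector_sub, apply_eq_fst_add_snd]
  -- A function is constant along its own Hamiltonian vector, so only the rotation part matters.
  have h1 : twistDeriv L i N κ p (0, hamVector (rotationDeriv L N p)
      - hamVector (twistDeriv L i N κ p))
      = twistDeriv L i N κ p (0, hamVector (rotationDeriv L N p)) := by
    have := apply_hamVector (twistDeriv L i N κ p)
    rw [show ((0 : ℝ), hamVector (rotationDeriv L N p) - hamVector (twistDeriv L i N κ p))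
      = (0, hamVector (rotationDeriv L N p)) - (0, hamVector (twistDeriv L i N κ p)) by simp,
      map_sub, this, sub_zero]
  simp only [one_mul]
  rw [h1, ← one_mul (twistDeriv L i N κ p (1, 0)), ← apply_eq_fst_add_snd _ (1, _),
    hamVector_rotationDeriv]
  -- Outside the support of the outer factor the differential of the twist is zero. Inside, the
  -- offsets `1` and `2` differ by the width of the smoothing, so the rotation already has full
  -- speed.
  rcases le_or_gt ((N : ℝ) * (1 - ‖p.2‖ ^ 2)) 2 with h | h
  · simp [twistDeriv, cap_eq_zero h, capSlope_eq_zero h]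
  · rw [capSlope_eq_one (c := 1) (by linarith), one_smul]
    simp only [twistDeriv, sub_apply, smul_apply, imSqDeriv, ContinuousLinearMap.comp_apply,
      phaseDeriv_rot L i hN, normSqDeriv_apply, inner_smul_right, inner_rot]
    simp

/-- Outside a ball of radius less than `1` the Hamiltonian is constant. -/
theorem plugHamDeriv_eq_zero {p : TubeVec m} (h : (N : ℝ) * (1 - ‖p.2‖ ^ 2) ≤ 1) :
    plugHamDeriv L i N κ p = 0 := by
  have h' : (N : ℝ) * (1 - ‖p.2‖ ^ 2) ≤ 2 := by linarith
  simp [plugHamDeriv, rotationDeriv, twistDeriv, capSlope_eq_zero h, capSlope_eq_zero h',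
    cap_eq_zero h']

theorem plugHamVal_eq_one {a ρ : ℝ} (h : (N : ℝ) * (1 - ρ) ≤ 1) : plugHamVal L N κ a ρ = 1 := by
  rw [plugHamVal, cap_eq_zero h, cap_eq_zero (by linarith)]
  simp

theorem plugDensityVal_eq_one {a ρ : ℝ} (h : (N : ℝ) * (1 - ρ) ≤ 1) :
    plugDensityVal L N κ a ρ = 1 := by
  have h' : (N : ℝ) * (1 - ρ) ≤ 2 := by linarith
  simp [plugDensityVal, capSlope_eq_zero h, capSlope_eq_zero h', cap_eq_zero h', cap_eq_zero h]

/-! ### Pointwise bounds on the density -/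

variable {a ρ : ℝ}

/-- In the worst case `a / (a + κ)` is replaced by `1` and the nonnegative terms are dropped,
leaving `1 - (1 - 2/N)`. The bound gives contactness and limits the speed of `s` to `N / 2`. -/
theorem two_div_le_plugDensityVal (hL : 0 < L) (hN : 2 ≤ N) (hκ : 0 < κ) (ha : 0 ≤ a)
    (hρ : 0 ≤ ρ) : 2 / (N : ℝ) ≤ plugDensityVal L N κ a ρ := by
  have hN0 : N ≠ 0 := by omega
  have h1 := cap_add_mul_capSlope_le (c := 2) hN0 (by exact_mod_cast hN) hρ
  have h2 : a / (a + κ) ≤ 1 := (div_le_one (by positivity)).2 (by linarith)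
  have h3 : 0 ≤ cap N 2 ρ + ρ * capSlope N 2 ρ :=
    add_nonneg cap_nonneg (mul_nonneg hρ capSlope_nonneg)
  have h4 : 0 ≤ Real.pi / (N * L) * (cap N 1 ρ + ρ * capSlope N 1 ρ) :=
    mul_nonneg (by positivity) (add_nonneg cap_nonneg (mul_nonneg hρ capSlope_nonneg))
  have h5 : 0 ≤ N * (a * κ) / (a + κ) ^ 2 * cap N 2 ρ := mul_nonneg (by positivity) cap_nonneg
  have h6 := mul_le_of_le_one_left h3 h2
  rw [plugDensityVal]
  linarith

/-- Either `a = 0`, or `cap` vanishes and with it its slope; in both cases the only negative term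
disappears. -/
theorem one_le_plugDensityVal (hL : 0 < L) (hN : N ≠ 0) (hκ : 0 < κ) (ha : 0 ≤ a) (hρ : 0 ≤ ρ)
    (h : a / (a + κ) * cap N 2 ρ = 0) : 1 ≤ plugDensityVal L N κ a ρ := by
  have h4 : 0 ≤ Real.pi / (N * L) * (cap N 1 ρ + ρ * capSlope N 1 ρ) :=
    mul_nonneg (by positivity) (add_nonneg cap_nonneg (mul_nonneg hρ capSlope_nonneg))
  have h5 : 0 ≤ N * (a * κ) / (a + κ) ^ 2 * cap N 2 ρ := mul_nonneg (by positivity) cap_nonneg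
  have h6 : a / (a + κ) * (cap N 2 ρ + ρ * capSlope N 2 ρ) = 0 := by
    rcases mul_eq_zero.1 h with h | h
    · rw [h, zero_mul]
    · have : (N : ℝ) * (1 - ρ) ≤ 2 := by
        by_contra! hlt
        exact (cap_pos hN hlt).ne' h
      rw [h, capSlope_eq_zero this]
      simp
  rw [plugDensityVal, h6]
  linarith

/-- Independence of `κ` is what makes this a dominating constant for `κ → 0`. -/
theorem plugDensityVal_le (hL : 0 < L) (hN : 2 ≤ N) (hκ : 0 < κ) (ha : 0 ≤ a) (hρ : 0 ≤ ρ) :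
    plugDensityVal L N κ a ρ ≤ 1 + Real.pi / L + N := by
  have hN0 : N ≠ 0 := by omega
  have hN1 : (1 : ℝ) ≤ N := by exact_mod_cast Nat.one_le_iff_ne_zero.2 hN0
  have h1 := cap_add_mul_capSlope_le (c := 1) hN0 hN1 hρ
  have h2 := cap_add_mul_capSlope_le (c := 2) hN0 (by exact_mod_cast hN) hρ
  have h3 : 0 ≤ a / (a + κ) * (cap N 2 ρ + ρ * capSlope N 2 ρ) :=
    mul_nonneg (by positivity) (add_nonneg cap_nonneg (mul_nonneg hρ capSlope_nonneg))
  have h4 : Real.pi / (N * L) * (cap N 1 ρ + ρ * capSlope N 1 ρ) ≤ Real.pi / L * 1 := by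
    refine mul_le_mul ?_ ?_ (add_nonneg cap_nonneg (mul_nonneg hρ capSlope_nonneg)) (by positivity)
    · exact div_le_div_of_nonneg_left Real.pi_pos.le hL (le_mul_of_one_le_left hL.le hN1)
    · exact h1.trans (sub_le_self _ (by positivity))
  have h5 : N * (a * κ) / (a + κ) ^ 2 * cap N 2 ρ ≤ N * 1 := by
    refine mul_le_mul ?_ ?_ cap_nonneg (by positivity)
    · rw [div_le_iff₀ (by positivity)]
      refine mul_le_mul_of_nonneg_left ?_ (by positivity)
      nlinarith [mul_nonneg ha hκ.le, sq_nonneg a, sq_nonneg κ]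
    · have h6 : 0 ≤ ρ * capSlope N 2 ρ := mul_nonneg hρ capSlope_nonneg
      have h7 : 0 ≤ 2 / (N : ℝ) := by positivity
      linarith
  rw [plugDensityVal]
  linarith

end Plug

/-! ### Small contact volume -/

section Volume

variable {L : ℝ} {m : ℕ} {i : Fin m} {N : ℕ} {κ : ℝ}

theorem continuous_circlePhase : Continuous (circlePhase (m := m) L i N) :=
  (continuous_induced_dom.comp (AddCircle.continuous_toCircle.comp continuous_fst.neg)).mul
    (((zcoord i).continuous.comp continuous_snd).pow N)

theorem continuous_cap (N : ℕ) (c : ℝ) : Continuous (cap N c) := (contDiff_cap N c).continuous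

theorem continuous_capSlope (N : ℕ) (c : ℝ) : Continuous (capSlope N c) :=
  Real.smoothTransition.continuous.comp (by fun_prop)

theorem continuous_plugDensity (hκ : 0 < κ) : Continuous (plugDensity (m := m) L i N κ) := by
  have hn : Continuous fun x : Tube L m => ‖x.2‖ ^ 2 := by fun_prop
  have hc : ∀ c, Continuous fun x : Tube L m => cap N c (‖x.2‖ ^ 2) := fun c =>
    (continuous_cap N c).comp hn
  have hs : ∀ c, Continuous fun x : Tube L m => capSlope N c (‖x.2‖ ^ 2) := fun c =>
    (continuous_capSlope N c).comp hn
  have ha : Continuous fun x : Tube L m => (circlePhase L i N x).im ^ 2 :=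
    (Complex.continuous_im.comp continuous_circlePhase).pow 2
  have hpos : ∀ x : Tube L m, (circlePhase L i N x).im ^ 2 + κ ≠ 0 := fun x => by positivity
  refine ((continuous_const.add (continuous_const.mul ((hc 1).add (hn.mul (hs 1))))).sub
    ((ha.div (ha.add continuous_const) hpos).mul ((hc 2).add (hn.mul (hs 2))))).add
    (((continuous_const.mul (ha.mul continuous_const)).div
      ((ha.add continuous_const).pow 2) fun x => pow_ne_zero 2 (hpos x)).mul (hc 2))

theorem isOpen_plug : IsOpen (plug L m) := isOpen_univ.prod Metric.isOpen_ball

theorem volume_plug_lt_top [Fact (0 < L)] : volume (plug L m) < ⊤ := by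
  rw [plug, Measure.volume_eq_prod, Measure.prod_prod]
  exact ENNReal.mul_lt_top (measure_lt_top _ _) measure_ball_lt_top

theorem finite_setOf_im_mul_eq_zero {c : ℂ} (hc : c ≠ 0) :
    {w : Circle | ((w : ℂ) * c).im = 0}.Finite := by
  refine Set.Finite.preimage (f := fun w : Circle => (w : ℂ)) (s := {(‖c‖ / c : ℂ), (-‖c‖ / c : ℂ)})
    Circle.coe_injective.injOn (by simp) |>.subset fun (w : Circle) hw => ?_
  replace hw : ((w : ℂ) * c).im = 0 := hw
  have h1 : (w : ℂ) * c = (((w : ℂ) * c).re : ℂ) := Complex.ext rfl (by simpa using hw)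
  have h2 : |((w : ℂ) * c).re| = ‖c‖ := by
    rw [← Real.norm_eq_abs, ← Complex.norm_real, ← h1, norm_mul, Circle.norm_coe, one_mul]
  change (w : ℂ) = ‖c‖ / c ∨ (w : ℂ) = -‖c‖ / c
  rw [eq_div_iff hc, eq_div_iff hc, h1]
  rcases abs_eq (norm_nonneg c) |>.1 h2 with h | h
  · exact Or.inl (by rw [h])
  · exact Or.inr (by rw [h]; simp)

/-- Fubini: `ζ = 0` is a proper linear subspace, and for `ζ ≠ 0` only finitely many `s` make the
phase real. -/
theorem ae_circlePhase_im_ne_zero [Fact (0 < L)] :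
    ∀ᵐ x : Tube L m, (circlePhase L i N x).im ≠ 0 := by
  have hclosed : IsClosed {x : Tube L m | (circlePhase L i N x).im = 0} :=
    isClosed_eq (Complex.continuous_im.comp continuous_circlePhase) continuous_const
  rw [ae_iff]
  simp only [not_not]
  rw [Measure.volume_eq_prod, Measure.prod_apply_symm hclosed.measurableSet,
    lintegral_eq_zero_iff' (measurable_measure_prodMk_right hclosed.measurableSet).aemeasurable]
  have hz : ∀ᵐ z : Plane m, zcoord i z ≠ 0 := by
    rw [ae_iff]
    simp only [not_not]
    have hne : LinearMap.ker (zcoord i : Plane m →ₗ[ℝ] ℂ) ≠ ⊤ := fun h => by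
      have : EuclideanSpace.single (i, (0 : Fin 2)) (1 : ℝ)
          ∈ LinearMap.ker (zcoord i : Plane m →ₗ[ℝ] ℂ) := h ▸ Submodule.mem_top
      simp [zcoord_apply] at this
    exact Measure.addHaar_submodule volume _ hne
  filter_upwards [hz] with z hz
  have hfin : {s : AddCircle L | ((AddCircle.toCircle (-s) : ℂ) * zcoord i z ^ N).im = 0}.Finite :=
    (finite_setOf_im_mul_eq_zero (pow_ne_zero N hz)).preimage
      ((AddCircle.injective_toCircle (Fact.out : 0 < L).ne').comp neg_injective).injOn
  have : NullSingletonClass (volume : Measure (AddCircle L)) := ⟨fun x => by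
    rw [← Metric.closedBall_zero, AddCircle.volume_closedBall]
    simp [(Fact.out : 0 < L).le]⟩
  exact hfin.measure_zero volume

/-- The pointwise limit of `plugDensityVal` for `κ → 0`. -/
def limitDensity (L : ℝ) (N : ℕ) (ρ : ℝ) : ℝ :=
  1 + Real.pi / (N * L) * (cap N 1 ρ + ρ * capSlope N 1 ρ) - (cap N 2 ρ + ρ * capSlope N 2 ρ)

/-- For `a > 0` the density is continuous at `κ = 0`; at `a = 0` this fails, whence the null set
above. -/
theorem tendsto_plugDensityVal {a ρ : ℝ} (ha : 0 < a) :
    Tendsto (fun κ => plugDensityVal L N κ a ρ) (𝓝 0) (𝓝 (limitDensity L N ρ)) := by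
  have h : ContinuousAt (fun κ => plugDensityVal L N κ a ρ) 0 := by
    unfold plugDensityVal
    have : a + 0 ≠ 0 := by positivity
    have h2 : (a + 0) ^ 2 ≠ 0 := by positivity
    fun_prop (disch := assumption)
  have h0 : plugDensityVal L N 0 a ρ = limitDensity L N ρ := by
    simp [plugDensityVal, limitDensity, ha.ne']
  rw [← h0]
  exact h

theorem integrableOn_plugDensity [Fact (0 < L)] (hN : 2 ≤ N) (hκ : 0 < κ) :
    IntegrableOn (plugDensity (m := m) L i N κ) (plug L m) := by
  refine IntegrableOn.of_bound volume_plug_lt_top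
    (continuous_plugDensity hκ).aestronglyMeasurable (1 + Real.pi / L + N)
    (Eventually.of_forall fun x => ?_)
  have h1 : 2 / (N : ℝ) ≤ plugDensity L i N κ x :=
    two_div_le_plugDensityVal Fact.out hN hκ (by positivity) (by positivity)
  have h0 : 0 ≤ 2 / (N : ℝ) := by positivity
  rw [Real.norm_of_nonneg (h0.trans h1)]
  exact plugDensityVal_le Fact.out hN hκ (by positivity) (by positivity)

theorem tendsto_integral_plugDensity [Fact (0 < L)] (hN : 2 ≤ N) :
    Tendsto (fun k : ℕ => ∫ x in plug L m, plugDensity L i N (1 / ((k : ℝ) + 1)) x) atTop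
      (𝓝 (∫ x in plug L m, limitDensity L N (‖x.2‖ ^ 2))) := by
  refine tendsto_integral_of_dominated_convergence (fun _ => 1 + Real.pi / L + N)
    (fun k => (integrableOn_plugDensity hN (by positivity)).aestronglyMeasurable)
    (integrableOn_const volume_plug_lt_top.ne) (fun k => Eventually.of_forall fun x => ?_) ?_
  · have hκ : 0 < 1 / ((k : ℝ) + 1) := by positivity
    have h1 : 2 / (N : ℝ) ≤ plugDensity L i N (1 / ((k : ℝ) + 1)) x :=
      two_div_le_plugDensityVal Fact.out hN hκ (by positivity) (by positivity)
    have h0 : 0 ≤ 2 / (N : ℝ) := by positivity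
    rw [Real.norm_of_nonneg (h0.trans h1)]
    exact plugDensityVal_le Fact.out hN hκ (by positivity) (by positivity)
  · filter_upwards [ae_restrict_of_ae ae_circlePhase_im_ne_zero] with x hx
    exact (tendsto_plugDensityVal (by positivity)).comp tendsto_one_div_add_atTop_nhds_zero_nat

theorem continuous_limitDensity : Continuous (limitDensity L N) := by
  have h1 := continuous_cap N
  have h2 := continuous_capSlope N
  unfold limitDensity
  fun_prop

theorem abs_limitDensity_le {ρ : ℝ} (hL : 0 < L) (hN : 2 ≤ N) (hρ : 0 ≤ ρ) :
    |limitDensity L N ρ| ≤ 1 + Real.pi / L := by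
  have hN0 : N ≠ 0 := by omega
  have hN1 : (1 : ℝ) ≤ N := by exact_mod_cast Nat.one_le_iff_ne_zero.2 hN0
  have h1 := cap_add_mul_capSlope_le (c := 1) hN0 hN1 hρ
  have h2 := cap_add_mul_capSlope_le (c := 2) hN0 (by exact_mod_cast hN) hρ
  have h3 : ∀ c, 0 ≤ cap N c ρ + ρ * capSlope N c ρ := fun c =>
    add_nonneg cap_nonneg (mul_nonneg hρ capSlope_nonneg)
  have h4 : Real.pi / (N * L) * (cap N 1 ρ + ρ * capSlope N 1 ρ) ≤ Real.pi / L * 1 := by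
    refine mul_le_mul ?_ ?_ (h3 1) (by positivity)
    · exact div_le_div_of_nonneg_left Real.pi_pos.le hL (le_mul_of_one_le_left hL.le hN1)
    · exact h1.trans (sub_le_self _ (by positivity))
  have h5 : 0 ≤ Real.pi / (N * L) * (cap N 1 ρ + ρ * capSlope N 1 ρ) :=
    mul_nonneg (by positivity) (h3 1)
  have h6 : 0 ≤ 2 / (N : ℝ) := by positivity
  have h7 := h3 2
  have h8 : 0 ≤ Real.pi / L := by positivity
  rw [abs_le, limitDensity]
  constructor <;> linarith

theorem tendsto_limitDensity {ρ : ℝ} (hL : 0 < L) (h0 : 0 ≤ ρ) (h1 : ρ < 1) :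
    Tendsto (fun k : ℕ => limitDensity L (k + 2) ρ) atTop (𝓝 0) := by
  -- Upper barrier: `π / L` comes from the rotation term, and `3 = 2 + 1` from the lower bound on
  -- the linear part of `cap N 2`.
  have hlim : Tendsto (fun k : ℕ => (Real.pi / L + 3) * (((k + 2 : ℕ) : ℝ))⁻¹) atTop (𝓝 0) := by
    have := ((tendsto_inv_atTop_nhds_zero_nat (𝕜 := ℝ)).comp (tendsto_add_atTop_nat 2)).const_mul
      (Real.pi / L + 3)
    simpa using this
  have hev : ∀ᶠ k : ℕ in atTop, 3 ≤ ((k + 2 : ℕ) : ℝ) * (1 - ρ) := by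
    have : Tendsto (fun k : ℕ => ((k + 2 : ℕ) : ℝ) * (1 - ρ)) atTop atTop :=
      (tendsto_natCast_atTop_atTop.comp (tendsto_add_atTop_nat 2)).atTop_mul_const (by linarith)
    exact this.eventually_ge_atTop 3
  refine tendsto_of_tendsto_of_tendsto_of_le_of_le' tendsto_const_nhds hlim ?_ ?_
  · refine Eventually.of_forall fun k => ?_
    have hN : k + 2 ≠ 0 := by omega
    have h2 := cap_add_mul_capSlope_le (c := 2) (ρ := ρ) hN 
      (by push_cast; linarith [k.cast_nonneg (α := ℝ)]) h0
    have h5 : 0 ≤ Real.pi / ((k + 2 : ℕ) * L) * (cap (k + 2) 1 ρ + ρ * capSlope (k + 2) 1 ρ) :=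
      mul_nonneg (by positivity) (add_nonneg cap_nonneg (mul_nonneg h0 capSlope_nonneg))
    have h6 : 0 ≤ 2 / ((k + 2 : ℕ) : ℝ) := by positivity
    rw [limitDensity]
    linarith
  · filter_upwards [hev] with k hk
    have hN : k + 2 ≠ 0 := by omega
    have h1' := cap_add_mul_capSlope_le (c := 1) (ρ := ρ) hN 
      (by push_cast; linarith [k.cast_nonneg (α := ℝ)]) h0
    have h2 := le_cap_add_mul_capSlope (c := 2) (ρ := ρ) hN (by linarith)
    have h5 : Real.pi / ((k + 2 : ℕ) * L) * (cap (k + 2) 1 ρ + ρ * capSlope (k + 2) 1 ρ)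
        ≤ Real.pi / ((k + 2 : ℕ) * L) * 1 :=
      mul_le_mul_of_nonneg_left (h1'.trans (sub_le_self _ (by positivity))) (by positivity)
    have h6 : (Real.pi / L + 3) * (((k + 2 : ℕ) : ℝ))⁻¹
        = Real.pi / ((k + 2 : ℕ) * L) * 1 + (2 + 1) / ((k + 2 : ℕ) : ℝ) := by
      field_simp
      ring
    rw [limitDensity, h6]
    linarith

theorem tendsto_integral_limitDensity [Fact (0 < L)] :
    Tendsto (fun k : ℕ => ∫ x in plug L m, limitDensity L (k + 2) (‖x.2‖ ^ 2)) atTop (𝓝 0) := by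
  have hL : 0 < L := Fact.out
  rw [← integral_zero (Tube L m) ℝ (μ := volume.restrict (plug L m))]
  refine tendsto_integral_of_dominated_convergence (fun _ => 1 + Real.pi / L)
    (fun k => (continuous_limitDensity.comp (by fun_prop)).aestronglyMeasurable)
    (integrableOn_const volume_plug_lt_top.ne) (fun k => Eventually.of_forall fun x => ?_) ?_
  · exact abs_limitDensity_le hL (by omega) (by positivity)
  · filter_upwards [ae_restrict_mem isOpen_plug.measurableSet] with x hx
    refine tendsto_limitDensity hL (by positivity) ?_
    have : ‖x.2‖ < 1 := by simpa [plug] using hx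
    exact pow_lt_one₀ (norm_nonneg _) this two_ne_zero

/-- `N` is fixed first through the limit density, then `κ`, since the bound on the density grows
with `N`. -/
theorem exists_integral_plugDensity_lt [Fact (0 < L)] (i : Fin m) {ε : ℝ} (hε : 0 < ε) :
    ∃ (N : ℕ) (κ : ℝ), 2 ≤ N ∧ 0 < κ ∧ ∫ x in plug L m, plugDensity L i N κ x < ε := by
  obtain ⟨n, hn⟩ :=
    ((tendsto_integral_limitDensity (L := L) (m := m)).eventually_lt_const hε).exists
  obtain ⟨k, hk⟩ := ((tendsto_integral_plugDensity (L := L) (i := i) (N := n + 2)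
    (by omega)).eventually_lt_const hn).exists
  exact ⟨n + 2, _, by omega, by positivity, hk⟩

end Volume

/-! ### Reeb curves on the universal covering -/

/-- The Reeb vector field of the plug on the universal covering. -/
def reebField (L : ℝ) {m : ℕ} (i : Fin m) (N : ℕ) (κ : ℝ) (p : TubeVec m) : TubeVec m :=
  (plugDensity L i N κ (cover L m p))⁻¹ • ((1 : ℝ), hamVector (plugHamDeriv L i N κ p))

section Reeb

variable {L : ℝ} {m : ℕ} {i : Fin m} {N : ℕ} {κ : ℝ}

theorem two_div_le_plugDensity (hL : 0 < L) (hN : 2 ≤ N) (hκ : 0 < κ) (x : Tube L m) :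
    2 / (N : ℝ) ≤ plugDensity L i N κ x :=
  two_div_le_plugDensityVal hL hN hκ (by positivity) (by positivity)

theorem plugDensity_pos (hL : 0 < L) (hN : 2 ≤ N) (hκ : 0 < κ) (x : Tube L m) :
    0 < plugDensity L i N κ x := by
  have hN' : (0 : ℝ) < N := by
    have : 0 < N := by omega
    exact_mod_cast this
  exact (div_pos two_pos hN').trans_le (two_div_le_plugDensity hL hN hκ x)

theorem isReebVector_plug_iff (hL : 0 < L) (hN : 2 ≤ N) (hκ : 0 < κ) (p v : TubeVec m) :
    IsReebVector (hamForm (plugHam L i N κ)) (cover L m p) v ↔ v = reebField L i N κ p := by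
  have hN0 : N ≠ 0 := by omega
  have h := isReebVector_hamForm_iff (hasFDerivAt_plugHam (L := L) (i := i) hN0 hκ p)
    (by rw [plugHam_sub_half_deriv hN0]; exact (plugDensity_pos hL hN hκ _).ne') v
  rw [plugHam_sub_half_deriv hN0] at h
  exact h

section Curve

variable {c : ℝ → TubeVec m} (hc : ∀ t, HasDerivAt c (reebField L i N κ (c t)) t)
include hc

theorem hasDerivAt_fst_of_reeb (t : ℝ) :
    HasDerivAt (fun t => (c t).1) (plugDensity L i N κ (cover L m (c t)))⁻¹ t := by
  have h : HasDerivAt (fun t => (c t).1) (reebField L i N κ (c t)).1 t :=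
    (ContinuousLinearMap.fst ℝ ℝ (Plane m)).hasFDerivAt.comp_hasDerivAt t (hc t)
  simpa [reebField] using h

theorem twist_eq_of_reeb (hN : N ≠ 0) (hκ : 0 < κ) (t s : ℝ) :
    twist L i N κ (c t) = twist L i N κ (c s) := by
  have h : ∀ t, HasDerivAt (fun t => twist L i N κ (c t)) 0 t := fun t => by
    have := (hasFDerivAt_twist (L := L) (i := i) hN hκ (c t)).comp_hasDerivAt t (hc t)
    rwa [reebField, map_smul, twistDeriv_hamVector hN, smul_zero] at this
  exact is_const_of_deriv_eq_zero (fun t => (h t).differentiableAt) (fun t => (h t).deriv) t s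

/-- The function `f` is conserved: it is locally flat where its ramp is off, and where it is on, the
Reeb field is `∂_s`. Its value separates interior points from points with norm at least `1`. -/
theorem norm_lt_one_of_reeb (hN : 2 ≤ N) (h0 : ‖(c 0).2‖ < 1) (t : ℝ) : ‖(c t).2‖ < 1 := by
  have hN' : (0 : ℝ) < N := by
    have : 0 < N := by omega
    exact_mod_cast this
  set f : ℝ → ℝ := fun t => ramp (1 - N * (1 - ‖(c t).2‖ ^ 2)) with hf
  have h : ∀ t, HasDerivAt f 0 t := fun t => by
    have h1 : HasDerivAt (fun t => ‖(c t).2‖ ^ 2) (normSqDeriv (c t) (reebField L i N κ (c t))) t :=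
      (hasFDerivAt_normSq (c t)).comp_hasDerivAt t (hc t)
    have h2 := (hasDerivAt_ramp _).comp t (((h1.const_sub 1).const_mul (N : ℝ)).const_sub 1)
    refine h2.congr_deriv ?_
    rcases le_total ((N : ℝ) * (1 - ‖(c t).2‖ ^ 2)) 1 with h | h
    · rw [reebField, plugHamDeriv_eq_zero h, hamVector_zero, normSqDeriv_apply]
      simp
    · rw [Real.smoothTransition.zero_of_nonpos (by linarith), zero_mul]
  have hconst : f t = f 0 :=
    is_const_of_deriv_eq_zero (fun t => (h t).differentiableAt) (fun t => (h t).deriv) t 0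
  by_contra! hge
  have h1 : 1 ≤ ‖(c t).2‖ ^ 2 := one_le_pow₀ hge
  have h2 : ‖(c 0).2‖ ^ 2 < 1 := pow_lt_one₀ (norm_nonneg _) h0 two_ne_zero
  have h3 : (1 : ℝ) - N * (1 - ‖(c 0).2‖ ^ 2) < 1 := by
    have := mul_pos hN' (sub_pos.2 h2)
    linarith
  have h4 : (1 : ℝ) ≤ 1 - N * (1 - ‖(c t).2‖ ^ 2) := by
    have := mul_nonneg hN'.le (sub_nonneg.2 h1)
    linarith
  have h5 : ramp 1 ≤ f t := monotone_ramp h4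
  have h6 : f 0 < ramp 1 := by
    rcases le_total 0 ((1 : ℝ) - N * (1 - ‖(c 0).2‖ ^ 2)) with h | h
    · exact strictMonoOn_ramp h (mem_Ici.2 zero_le_one) h3
    · simp only [hf]
      rw [ramp_of_nonpos h]
      exact ramp_pos one_pos
  linarith

theorem fst_sub_le_of_reeb {b : ℝ} (hb : ∀ t, (plugDensity L i N κ (cover L m (c t)))⁻¹ ≤ b)
    {T : ℝ} (hT : 0 ≤ T) : (c T).1 - (c 0).1 ≤ b * T := by
  have h : ∀ t, HasDerivAt (fun t => b * t - (c t).1)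
      (b - (plugDensity L i N κ (cover L m (c t)))⁻¹) t := fun t => by
    have := ((hasDerivAt_id t).const_mul b).sub (hasDerivAt_fst_of_reeb hc t)
    rwa [mul_one] at this
  have hm : Monotone fun t => b * t - (c t).1 :=
    monotone_of_deriv_nonneg (fun t => (h t).differentiableAt) fun t => by
      rw [(h t).deriv]
      exact sub_nonneg.2 (hb t)
  have := hm hT
  simp only [mul_zero] at this
  linarith

theorem strictMono_fst_of_reeb (hL : 0 < L) (hN : 2 ≤ N) (hκ : 0 < κ) :
    StrictMono fun t => (c t).1 :=
  strictMono_of_deriv_pos fun t => by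
    rw [(hasDerivAt_fst_of_reeb hc t).deriv]
    exact inv_pos.2 (plugDensity_pos hL hN hκ _)

/-- While the orbit stays in the twisted region, it needs at least `N` turns to close up. -/
theorem exists_int_of_twist_ne_zero (hL : 0 < L) (hN : N ≠ 0) (hκ : 0 < κ) {T : ℝ}
    (hT : cover L m (c T) = cover L m (c 0)) (h0 : twist L i N κ (c 0) ≠ 0) :
    ∃ n : ℤ, (c T).1 - (c 0).1 = n * (N * L) := by
  have hN' : (N : ℂ) ≠ 0 := Nat.cast_ne_zero.2 hN
  have hcc : Continuous c := continuous_iff_continuousAt.2 fun t => (hc t).continuousAt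
  -- The twist is conserved and nonzero, so the phase stays off the real axis.
  have him : ∀ t, (phase L i N (c t)).im ≠ 0 := fun t h => by
    apply h0
    rw [← twist_eq_of_reeb hc hN hκ t 0, twist, h]
    simp
  -- Division by `N` makes `e * ζ` an `N`-th root of the phase; it is well defined only on the
  -- covering.
  set e : ℝ → ℂ := fun t => Complex.exp (((2 * Real.pi / L * (-(c t).1) / N : ℝ) : ℂ) * Complex.I)
    with he
  have hz : (c T).2 = (c 0).2 :=
    show (cover L m (c T)).2 = (cover L m (c 0)).2 by rw [hT]
  have huV : ∀ t, (e t * zcoord i (c t).2) ^ N = phase L i N (c t) := fun t => by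
    rw [mul_pow, he, phase, ← Complex.exp_nat_mul]
    congr 2
    push_cast
    field_simp
  have hroot := root_eq_of_slitPlane hN (u := fun t => e t * zcoord i (c t).2)
    (V := fun t => phase L i N (c t)) (by fun_prop) ((contDiff_phase L i N).continuous.comp hcc)
    huV (fun t => Complex.mem_slitPlane_iff.2 (Or.inr (him t))) (a := T) (b := 0)
    (by rw [← circlePhase_cover, hT, circlePhase_cover])
  simp only [hz] at hroot
  have hz0 : zcoord i (c 0).2 ≠ 0 := fun h => by
    apply him 0
    rw [← huV, h, mul_zero, zero_pow hN]
    simp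
  -- The root closes up and so does `ζ ≠ 0`, hence so does `e`, whose period in `s` is `N * L`.
  have hexp := mul_right_cancel₀ hz0 hroot
  obtain ⟨n, hn⟩ := Complex.exp_eq_exp_iff_exists_int.1 hexp
  refine ⟨-n, ?_⟩
  have h1 : (((2 * Real.pi / L * (-(c T).1) / N : ℝ) : ℂ))
      = ((2 * Real.pi / L * (-(c 0).1) / N + n * (2 * Real.pi) : ℝ) : ℂ) := by
    apply mul_right_cancel₀ Complex.I_ne_zero
    rw [hn]
    push_cast
    ring
  have h2 := Complex.ofReal_injective h1
  have hpi := Real.pi_ne_zero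
  field_simp at h2
  push_cast
  linarith

theorem le_period_of_reeb (hL : 0 < L) (hN : 2 ≤ N) (hκ : 0 < κ) {T : ℝ} (hT0 : 0 < T)
    (hT : cover L m (c T) = cover L m (c 0)) : L ≤ T := by
  have hN0 : N ≠ 0 := by omega
  have hN' : (0 : ℝ) < N := by positivity
  have hmono := strictMono_fst_of_reeb hc hL hN hκ hT0
  simp only at hmono
  by_cases h0 : twist L i N κ (c 0) = 0
  · have h1 := fst_sub_le_of_reeb hc (b := 1) (fun t => by
      refine inv_le_one_of_one_le₀ ?_
      refine one_le_plugDensityVal hL hN0 hκ (by positivity) (by positivity) ?_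
      rw [circlePhase_cover]
      exact (twist_eq_of_reeb hc hN0 hκ t 0).trans h0) hT0.le
    have h2 : ((c T).1 : AddCircle L) = ((c 0).1 : AddCircle L) :=
      show (cover L m (c T)).1 = (cover L m (c 0)).1 by rw [hT]
    rw [← sub_eq_zero, ← AddCircle.coe_sub, AddCircle.coe_eq_zero_iff] at h2
    obtain ⟨n, hn⟩ := h2
    rw [zsmul_eq_mul] at hn
    have h3 : (0 : ℝ) < n * L := by linarith
    have h4 : (0 : ℝ) < n := pos_of_mul_pos_left h3 hL.le
    have h5 : (1 : ℝ) ≤ n := by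
      have : (0 : ℤ) < n := by exact_mod_cast h4
      exact_mod_cast this
    have h6 : 1 * L ≤ n * L := mul_le_mul_of_nonneg_right h5 hL.le
    linarith
  · obtain ⟨n, hn⟩ := exists_int_of_twist_ne_zero hc hL hN0 hκ hT h0
    -- At speed at most `N / 2`, covering `N * L` takes time at least `2 * L`.
    have h1 := fst_sub_le_of_reeb hc (b := N / 2) (fun t => by
      have := inv_anti₀ (by positivity) (two_div_le_plugDensity hL hN hκ (i := i) (cover L m (c t)))
      rwa [inv_div] at this) hT0.le
    have h2 : (0 : ℝ) < n * (N * L) := by linarith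
    have h3 : (0 : ℝ) < n := pos_of_mul_pos_left h2 (by positivity)
    have h4 : (1 : ℝ) ≤ n := by
      have : (0 : ℤ) < n := by exact_mod_cast h3
      exact_mod_cast this
    have h5 : 1 * (N * L) ≤ n * (N * L) := mul_le_mul_of_nonneg_right h4 (by positivity)
    have h6 : N * (2 * L) ≤ N * T := by linarith
    have := le_of_mul_le_mul_left h6 hN'
    linarith

end Curve

end Reeb

/-! ### Global Reeb flow and periods of closed orbits -/

section Flow

variable {L : ℝ} {m : ℕ} {i : Fin m} {N : ℕ} {κ : ℝ}

theorem plugHamDeriv_eq_fderiv (hN : N ≠ 0) (hκ : 0 < κ) :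
    plugHamDeriv (m := m) L i N κ = fderiv ℝ (plugHamLift L i N κ) :=
  funext fun p => (hasFDerivAt_plugHamLift hN hκ p).fderiv.symm

theorem contDiff_plugHamDeriv (hN : N ≠ 0) (hκ : 0 < κ) :
    ContDiff ℝ ∞ (plugHamDeriv (m := m) L i N κ) := by
  rw [plugHamDeriv_eq_fderiv hN hκ]
  exact (contDiff_plugHamLift hκ).fderiv_right (by simp)

theorem contDiff_reebField (hL : 0 < L) (hN : 2 ≤ N) (hκ : 0 < κ) :
    ContDiff ℝ ∞ (reebField (m := m) L i N κ) := by
  have hN0 : N ≠ 0 := by omega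
  have hD := contDiff_plugHamDeriv (L := L) (i := i) hN0 hκ
  have h1 : ContDiff ℝ ∞ fun p : TubeVec m => plugDensity L i N κ (cover L m p) := by
    simp only [← plugHamLift_sub_half_deriv hN0]
    exact (contDiff_plugHamLift hκ).sub (contDiff_const.mul
      (hD.clm_apply (contDiff_const.prodMk contDiff_snd)))
  refine (h1.inv fun p => (plugDensity_pos hL hN hκ _).ne').smul (contDiff_const.prodMk ?_)
  rw [contDiff_euclidean]
  rintro ⟨j, k⟩
  fin_cases k
  · exact hD.clm_apply contDiff_const
  · exact (hD.clm_apply contDiff_const).neg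

theorem cover_add_period (p : TubeVec m) : cover L m (p + (L, 0)) = cover L m p := by
  simp [cover]

theorem reebField_add_period (hN : N ≠ 0) (hκ : 0 < κ) (p : TubeVec m) :
    reebField L i N κ (p + (L, 0)) = reebField L i N κ p := by
  have hper : (fun q : TubeVec m => plugHamLift L i N κ (q + (L, 0))) = plugHamLift L i N κ :=
    funext fun q => by rw [← plugHam_cover, cover_add_period, plugHam_cover]
  rw [reebField, reebField, cover_add_period, plugHamDeriv_eq_fderiv hN hκ,
    ← fderiv_comp_add_right, hper]

theorem reebField_eq (p : TubeVec m) (h : (N : ℝ) * (1 - ‖p.2‖ ^ 2) ≤ 1) :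
    reebField L i N κ p = (1, 0) := by
  rw [reebField, plugHamDeriv_eq_zero h, plugDensity_cover, plugDensityVal_eq_one h, hamVector_zero]
  simp

theorem mul_one_sub_lt {z : Plane m} (h : 1 ≤ ‖z‖) : (N : ℝ) * (1 - ‖z‖ ^ 2) < 1 := by
  have h1 : 1 ≤ ‖z‖ ^ 2 := one_le_pow₀ h
  have : (N : ℝ) * (1 - ‖z‖ ^ 2) ≤ 0 :=
    mul_nonpos_of_nonneg_of_nonpos N.cast_nonneg (by linarith)
  linarith

/-- The field and its derivative are periodic in `s` and constant for `‖z‖ ≥ 1`, so compactness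
bounds both. -/
theorem exists_reeb_curve (hL : 0 < L) (hN : 2 ≤ N) (hκ : 0 < κ) (p : TubeVec m) :
    ∃ c : ℝ → TubeVec m, c 0 = p ∧ ∀ t, HasDerivAt c (reebField L i N κ (c t)) t := by
  have hN0 : N ≠ 0 := by omega
  have hs := contDiff_reebField (m := m) (i := i) hL hN hκ
  obtain ⟨M, hM⟩ := exists_bound_of_periodic hL hs.continuous (reebField_add_period hN0 hκ)
    (a := (1, 0)) fun p hp => reebField_eq p (mul_one_sub_lt hp).le
  obtain ⟨K, hK⟩ := exists_bound_of_periodic hL (hs.continuous_fderiv (by simp))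
    (fun p => by
      rw [← fderiv_comp_add_right]
      simp only [reebField_add_period hN0 hκ])
    (a := 0) fun p hp => by
      have hev : reebField L i N κ =ᶠ[𝓝 p] fun _ => ((1 : ℝ), (0 : Plane m)) := by
        have hopen : IsOpen {p : TubeVec m | (N : ℝ) * (1 - ‖p.2‖ ^ 2) < 1} :=
          isOpen_lt (by fun_prop) continuous_const
        filter_upwards [hopen.mem_nhds (mul_one_sub_lt hp)] with q hq
        exact reebField_eq q (le_of_lt hq)
      rw [hev.fderiv_eq]
      simp
  have hlip : LipschitzWith ⟨K, (norm_nonneg _).trans (hK 0)⟩ (reebField (m := m) L i N κ) :=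
    lipschitzWith_of_nnnorm_fderiv_le (hs.differentiable (by simp)) fun p => hK p
  exact exists_hasDerivAt_of_lipschitz_of_bounded hlip hM p

theorem cover_mem_plug {p : TubeVec m} : cover L m p ∈ plug L m ↔ ‖p.2‖ < 1 := by
  simp [plug, cover]

theorem exists_isReebOrbit (hL : 0 < L) (hN : 2 ≤ N) (hκ : 0 < κ) {x : Tube L m}
    (hx : x ∈ plug L m) : ∃ γ, IsReebOrbit (hamForm (plugHam L i N κ)) γ ∧ γ 0 = x := by
  obtain ⟨p, rfl⟩ := cover_surjective x
  obtain ⟨c, h0, hc⟩ := exists_reeb_curve (i := i) hL hN hκ p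
  refine ⟨fun t => cover L m (c t), fun t => ⟨?_, reebField L i N κ (c t), ?_, c, ?_, hc t⟩, ?_⟩
  · exact cover_mem_plug.2 (norm_lt_one_of_reeb hc hN (h0 ▸ cover_mem_plug.1 hx) t)
  · exact (isReebVector_plug_iff hL hN hκ _ _).2 rfl
  · exact Eventually.of_forall fun _ => rfl
  · simp only [h0]

theorem le_period_of_isReebOrbit [Fact (0 < L)] (hN : 2 ≤ N) (hκ : 0 < κ) {γ : ℝ → Tube L m}
    {T : ℝ} (hγ : IsReebOrbit (hamForm (plugHam L i N κ)) γ) (hT0 : 0 < T)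
    (hT : Function.Periodic γ T) : L ≤ T := by
  have hL : 0 < L := Fact.out
  choose hmem w hw hv using hγ
  have hreeb : ∀ t p, cover L m p = γ t → w t = reebField L i N κ p := fun t p hp =>
    (isReebVector_plug_iff hL hN hκ p _).1 (hp ▸ hw t)
  have hγc : Continuous γ := continuous_iff_continuousAt.2 fun t => (hv t).continuousAt
  -- The density is a continuous function on the tube itself, which supplies the continuity needed
  -- for lifting.
  have hw1 : (fun t => (w t).1) = fun t => (plugDensity L i N κ (γ t))⁻¹ := funext fun t => by
    obtain ⟨p, hp⟩ := cover_surjective (γ t)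
    rw [hreeb t p hp, ← hp]
    simp [reebField]
  obtain ⟨c, hcγ, hc⟩ := exists_lift hv (by
    rw [hw1]
    exact ((continuous_plugDensity hκ).comp hγc).inv₀ fun t => (plugDensity_pos hL hN hκ _).ne')
  refine le_period_of_reeb (c := c) (i := i) (fun t => hreeb t _ (hcγ t) ▸ hc t) hL hN hκ hT0 ?_
  rw [hcγ, hcγ]
  simpa using hT 0

end Flow

/-! ### Contact condition, boundary collar and isotopy -/

section Contact

variable {L : ℝ} {m : ℕ}

theorem smoothForm_hamForm {H : Tube L m → ℝ}
    (hH : ContDiff ℝ ∞ fun p : TubeVec m => H (cover L m p)) : SmoothForm (hamForm H) := by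
  have h : ContDiff ℝ ∞ fun p : TubeVec m => hamForm H (cover L m p) :=
    (hH.smul contDiff_const).add
      ((liouvilleBilin m).bilinearComp (ContinuousLinearMap.snd ℝ ℝ (Plane m))
        (ContinuousLinearMap.snd ℝ ℝ (Plane m))).contDiff
  exact h.contDiffOn

theorem topForm_hamForm_ne_zero {H : Tube L m → ℝ} {x : Tube L m} {D : TubeVec m →L[ℝ] ℝ}
    (hD : HasFDerivAt (fun p => H (x + cover L m p)) D 0)
    (hpos : 0 < H x - 1 / 2 * D (0, x.2)) : topForm (hamForm H) x ≠ 0 := fun h => by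
  have h1 := volDensity_hamForm hD
  rw [volDensity, h] at h1
  exact (mul_pos (symplecticConst_pos m) hpos).ne h1

variable {i : Fin m} {N : ℕ} {κ : ℝ}

/-- Because the density is affine in the Hamiltonian, it becomes `(1 - t)` times the plug density
plus `t`, which is positive. -/
theorem isContactForm_interpolation (hL : 0 < L) (hN : 2 ≤ N) (hκ : 0 < κ) {t : ℝ}
    (ht : t ∈ Icc (0 : ℝ) 1) :
    IsContactForm (hamForm fun x : Tube L m => (1 - t) * plugHam L i N κ x + t) := by
  have hN0 : N ≠ 0 := by omega
  refine ⟨smoothForm_hamForm ?_, fun x _ => ?_⟩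
  · simp only [plugHam_cover]
    exact (contDiff_const.mul (contDiff_plugHamLift hκ)).add contDiff_const
  · obtain ⟨p, rfl⟩ := cover_surjective x
    have hD := ((hasFDerivAt_plugHam (L := L) (i := i) hN0 hκ p).const_mul (1 - t)).add_const t
    refine topForm_hamForm_ne_zero hD ?_
    have h1 := plugHam_sub_half_deriv (L := L) (i := i) (κ := κ) hN0 p
    have h2 := plugDensity_pos (i := i) hL hN hκ (cover L m p)
    simp only [smul_apply, smul_eq_mul]
    have h3 : (1 - t) * plugHam L i N κ (cover L m p) + t
        - 1 / 2 * ((1 - t) * plugHamDeriv L i N κ p (0, (cover L m p).2))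
        = (1 - t) * plugDensity L i N κ (cover L m p) + t := by
      rw [← h1]
      ring
    rw [h3]
    rcases ht.1.eq_or_lt with h | h
    · rw [← h]
      simpa using h2
    · exact add_pos_of_nonneg_of_pos (mul_nonneg (by linarith [ht.2]) h2.le) h

theorem isContactForm_plug (hL : 0 < L) (hN : 2 ≤ N) (hκ : 0 < κ) :
    IsContactForm (hamForm (plugHam (m := m) L i N κ)) := by
  simpa using isContactForm_interpolation (i := i) hL hN hκ (left_mem_Icc.2 zero_le_one)

/-- The neighbourhood of the boundary on which the plug is standard. -/
def collar (L : ℝ) (m N : ℕ) : Set (Tube L m) := {x | (N : ℝ) * (1 - ‖x.2‖ ^ 2) < 1}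

theorem isBoundaryNhd_collar : IsBoundaryNhd (collar L m N) := by
  refine ⟨isOpen_lt (by fun_prop) continuous_const, fun x hx => mul_one_sub_lt ?_⟩
  rw [isOpen_plug.frontier_eq] at hx
  by_contra! h
  exact hx.2 (by simpa [plug] using h)

theorem plugHam_eq_one {x : Tube L m} (hx : x ∈ collar L m N) : plugHam L i N κ x = 1 :=
  plugHamVal_eq_one (le_of_lt hx)

theorem isReebVector_collar_iff (hL : 0 < L) (hN : 2 ≤ N) (hκ : 0 < κ) {x : Tube L m}
    (hx : x ∈ collar L m N) (v : TubeVec m) :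
    IsReebVector (hamForm (plugHam L i N κ)) x v ↔ v = (1, 0) := by
  obtain ⟨p, rfl⟩ := cover_surjective x
  rw [isReebVector_plug_iff hL hN hκ, reebField_eq p (le_of_lt hx)]

theorem contactIsotopic_plug (hL : 0 < L) (hN : 2 ≤ N) (hκ : 0 < κ) :
    ContactIsotopicRelBoundary (hamForm (plugHam (m := m) L i N κ)) (stdForm L m) := by
  refine ⟨fun t => hamForm fun x => (1 - t) * plugHam L i N κ x + t, collar L m N, ?_,
    fun t ht => isContactForm_interpolation hL hN hκ ht, fun x _ => ?_, fun x _ => ?_,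
    isBoundaryNhd_collar, fun t _ x hx => ?_⟩
  · have h : ContDiff ℝ ∞ fun q : ℝ × TubeVec m =>
        hamForm (fun x => (1 - q.1) * plugHam L i N κ x + q.1) (cover L m q.2) := by
      refine ContDiff.add ?_ (((liouvilleBilin m).bilinearComp
        (ContinuousLinearMap.snd ℝ ℝ (Plane m))
        (ContinuousLinearMap.snd ℝ ℝ (Plane m))).contDiff.comp contDiff_snd)
      simp only [plugHam_cover]
      exact (((contDiff_const.sub contDiff_fst).mul
        ((contDiff_plugHamLift hκ).comp contDiff_snd)).add contDiff_fst).smul contDiff_const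
    exact h.contDiffOn
  · simp
  · exact hamForm_eq_stdForm (by simp)
  · refine hamForm_eq_stdForm ?_
    rw [plugHam_eq_one hx.1]
    ring

theorem volDensity_plug (hN : 2 ≤ N) (hκ : 0 < κ) :
    volDensity (hamForm (plugHam (m := m) L i N κ))
      = fun x => symplecticConst m * plugDensity L i N κ x := by
  have hN0 : N ≠ 0 := by omega
  funext x
  obtain ⟨p, rfl⟩ := cover_surjective x
  rw [volDensity_hamForm (hasFDerivAt_plugHam hN0 hκ p), plugHam_sub_half_deriv hN0]

end Contact

end ContactPlug

end

/-! ### Assembly -/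

theorem mainTheorem4 (m : ℕ) (hm : 2 ≤ m) (L : ℝ) [Fact (0 < L)] (ε : ℝ) (hε : 0 < ε) :
    ∃ β : ContactPlug.OneForm L m,
      ContactPlug.IsContactForm β ∧
      -- the contact volume is at most `ε`
      (IntegrableOn (ContactPlug.volDensity β) (ContactPlug.plug L m) ∧
        ContactPlug.contactVolume β ≤ ε) ∧
      -- near the boundary the form is `ds + λ` and its Reeb vector field is `∂_s`
      (∃ U : Set (ContactPlug.Tube L m), ContactPlug.IsBoundaryNhd U ∧
        ∀ x ∈ U ∩ ContactPlug.plug L m, β x = ContactPlug.stdForm L m x ∧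
          ∀ v : ContactPlug.TubeVec m, ContactPlug.IsReebVector β x v ↔ v = (1, 0)) ∧
      -- the Reeb flow is globally defined
      (∀ x ∈ ContactPlug.plug L m, ∃ γ : ℝ → ContactPlug.Tube L m,
        ContactPlug.IsReebOrbit β γ ∧ γ 0 = x) ∧
      -- every period of every closed Reeb orbit is at least `L`
      (∀ (γ : ℝ → ContactPlug.Tube L m) (T : ℝ), ContactPlug.IsReebOrbit β γ →
        0 < T → Function.Periodic γ T → L ≤ T) ∧
      -- the form is isotopic to `ds + λ` through contact forms, relative to the boundary
      ContactPlug.ContactIsotopicRelBoundary β (ContactPlug.stdForm L m) := by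
  have hL : 0 < L := Fact.out
  have hC := ContactPlug.symplecticConst_pos m
  -- The contact volume is `symplecticConst m` times the integral of the density, so `ε` is divided
  -- by that constant.
  obtain ⟨N, κ, hN, hκ, hvol⟩ := ContactPlug.exists_integral_plugDensity_lt (L := L)
    (⟨0, by omega⟩ : Fin m) (div_pos hε hC)
  refine ⟨ContactPlug.hamForm (ContactPlug.plugHam L ⟨0, by omega⟩ N κ),
    ContactPlug.isContactForm_plug hL hN hκ, ⟨?_, ?_⟩,
    ⟨ContactPlug.collar L m N, ContactPlug.isBoundaryNhd_collar, fun x hx =>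
      ⟨ContactPlug.hamForm_eq_stdForm (ContactPlug.plugHam_eq_one hx.1),
        ContactPlug.isReebVector_collar_iff hL hN hκ hx.1⟩⟩,
    fun x hx => ContactPlug.exists_isReebOrbit hL hN hκ hx,
    fun γ T hγ hT0 hT => ContactPlug.le_period_of_isReebOrbit hN hκ hγ hT0 hT,
    ContactPlug.contactIsotopic_plug hL hN hκ⟩
  · rw [ContactPlug.volDensity_plug hN hκ]
    exact (ContactPlug.integrableOn_plugDensity hN hκ).const_mul _
  · rw [ContactPlug.contactVolume, ContactPlug.volDensity_plug hN hκ,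
      MeasureTheory.integral_const_mul]
    rw [lt_div_iff₀ hC] at hvol
    linarith
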